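/- Let $N\ge 2$, let $\omega_N$ be the volume of the unit ball of $\mathbb{R}^N$, and let $2^*=\frac{2N}{N-2}$ if $N\ge 3$, $2^*=+\infty$ if $N=2$. Let $1\le q<2^*$ (with $q$ finite) and let $\Omega\subset\mathbb{R}^N$ be a bounded open set. For $0<s<1$ put $$[u]^2_{W^{s,2}(\mathbb{R}^N)}=\iint_{\mathbb{R}^N\times\mathbb{R}^N}\frac{|u(x)-u(y)|^2}{|x-y|^{N+2s}}\,dx\,dy .$$ Let $\mathcal{D}^{s,2}_0(\Omega)$ be the completion of $C^\infty_0(\Omega)$ with respect to the norm $[\,\cdot\,]_{W^{s,2}(\mathbb{R}^N)}$, and $\mathcal{D}^{1,2}_0(\Omega)$ its completion with respect to $\|\nabla\,\cdot\,\|_{L^2(\Omega)}$, both regarded as spaces of functions on $\mathbb{R}^N$ vanishing a.e. outside $\Omega$ (limits in norm and in $L^1_{\mathrm{loc}}(\mathbb{R}^N)$ of functions in $C_0^\infty(\Omega)$). Define $$\lambda_{s,q}(\Omega)=\inf_{u\in\mathcal{D}^{s,2}_0(\Omega)}\Big\{[u]^2_{W^{s,2}(\mathbb{R}^N)}:\|u\|_{L^q(\Omega)}=1\Big\},\qquad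 \lambda_{1,q}(\Omega)=\inf_{u\in\mathcal{D}^{1,2}_0(\Omega)}\Big\{\|\nabla u\|^2_{L^2(\Omega)}:\|u\|_{L^q(\Omega)}=1\Big\},$$ with $\inf\emptyset=+\infty$. Then $$\limsup_{s\nearrow 1}\,(1-s)\,\lambda_{s,q}(\Omega)\le\frac{\omega_N}{2}\,\lambda_{1,q}(\Omega).$$ If in addition $\Omega$ has Lipschitz boundary (near each boundary point, in suitable orthonormal coordinates, $\Omega$ is the region lying on one side of the graph of a Lipschitz function), then the limit of $(1-s)\,\lambda_{s,q}(\Omega)$ as $s\nearrow 1$ exists and $$\lim_{s\nearrow 1}\,(1-s)\,\lambda_{s,q}(\Omega)=\frac{\omega_N}{2}\,\lambda_{1,q}(\Omega).$$ -/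

import Mathlib

open MeasureTheory Set Filter Topology
open scoped ENNReal ContDiff

noncomputable section

/-- `C₀^∞(Ω)`: smooth real functions on `ℝ^N` with compact support contained in `Ω`. -/
structure IsTestFunction {N : ℕ} (Ω : Set (EuclideanSpace ℝ (Fin N)))
    (φ : EuclideanSpace ℝ (Fin N) → ℝ) : Prop where
  smooth : ContDiff ℝ ∞ φ
  compact : HasCompactSupport φ
  support : tsupport φ ⊆ Ω

/-- The squared Gagliardo seminorm
`[u]²_{W^{s,2}(ℝ^N)} = ∬ |u(x) - u(y)|² / |x - y|^{N + 2s} dx dy`, as a value in `[0, ∞]`. -/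
def gagliardoSq {N : ℕ} (s : ℝ) (u : EuclideanSpace ℝ (Fin N) → ℝ) : ℝ≥0∞ :=
  ∫⁻ z : EuclideanSpace ℝ (Fin N) × EuclideanSpace ℝ (Fin N),
    ENNReal.ofReal ((u z.1 - u z.2) ^ 2 / ‖z.1 - z.2‖ ^ ((N : ℝ) + 2 * s))

/-- Convergence in `L¹_loc(ℝ^N)`. -/
def TendstoL1loc {N : ℕ} (φ : ℕ → EuclideanSpace ℝ (Fin N) → ℝ)
    (u : EuclideanSpace ℝ (Fin N) → ℝ) : Prop :=
  ∀ K : Set (EuclideanSpace ℝ (Fin N)), IsCompact K →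
    Tendsto (fun n => ∫⁻ x in K, ‖φ n x - u x‖ₑ) atTop (𝓝 0)

/-- The homogeneous space `D₀^{s,2}(Ω)`, the completion of `C₀^∞(Ω)` for the norm
`[·]_{W^{s,2}(ℝ^N)}`, realized as a space of functions on `ℝ^N` (so that functions in it vanish
almost everywhere outside `Ω`): the limits, for this norm and in `L¹_loc`, of test functions. -/
structure MemFracD0 {N : ℕ} (s : ℝ) (Ω : Set (EuclideanSpace ℝ (Fin N)))
    (u : EuclideanSpace ℝ (Fin N) → ℝ) : Prop where
  aesm : AEStronglyMeasurable u volume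
  approx : ∃ φ : ℕ → EuclideanSpace ℝ (Fin N) → ℝ, (∀ n, IsTestFunction Ω (φ n)) ∧
    Tendsto (fun n => gagliardoSq s (fun x => φ n x - u x)) atTop (𝓝 0) ∧ TendstoL1loc φ u

/-- `λ_{s,q}(Ω)`, the infimum of `[u]²_{W^{s,2}(ℝ^N)}` over the `u ∈ D₀^{s,2}(Ω)` with
`‖u‖_{L^q(Ω)} = 1`, as a value in `[0, ∞]`. -/
def fracPoincareSobolev {N : ℕ} (s q : ℝ) (Ω : Set (EuclideanSpace ℝ (Fin N))) : ℝ≥0∞ :=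
  sInf {E : ℝ≥0∞ | ∃ u : EuclideanSpace ℝ (Fin N) → ℝ, MemFracD0 s Ω u ∧
    eLpNorm u (ENNReal.ofReal q) (volume.restrict Ω) = 1 ∧ E = gagliardoSq s u}

/-- `G` is the weak gradient of `u` on `ℝ^N`. -/
structure HasWeakGradient {N : ℕ} (u : EuclideanSpace ℝ (Fin N) → ℝ)
    (G : EuclideanSpace ℝ (Fin N) → EuclideanSpace ℝ (Fin N)) : Prop where
  locInt : LocallyIntegrable u volume
  locInt_grad : LocallyIntegrable G volume
  byParts : ∀ ψ : EuclideanSpace ℝ (Fin N) → ℝ, IsTestFunction univ ψ →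
    ∀ v : EuclideanSpace ℝ (Fin N),
      ∫ x, u x * fderiv ℝ ψ x v = -∫ x, inner ℝ (G x) v * ψ x

/-- The homogeneous space `D₀^{1,2}(Ω)`, the completion of `C₀^∞(Ω)` for the norm
`‖∇·‖_{L²}`, realized as a space of functions on `ℝ^N`. -/
def MemD0 {N : ℕ} (Ω : Set (EuclideanSpace ℝ (Fin N)))
    (u : EuclideanSpace ℝ (Fin N) → ℝ) : Prop :=
  ∃ G : EuclideanSpace ℝ (Fin N) → EuclideanSpace ℝ (Fin N), HasWeakGradient u G ∧
    ∃ φ : ℕ → EuclideanSpace ℝ (Fin N) → ℝ, (∀ n, IsTestFunction Ω (φ n)) ∧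
      Tendsto (fun n => ∫⁻ x, ‖gradient (φ n) x - G x‖ₑ ^ 2) atTop (𝓝 0) ∧ TendstoL1loc φ u

/-- `λ_{1,q}(Ω)`, the infimum of `‖∇u‖²_{L²(Ω)}` over the `u ∈ D₀^{1,2}(Ω)` with
`‖u‖_{L^q(Ω)} = 1`, as a value in `[0, ∞]`. -/
def poincareSobolev {N : ℕ} (q : ℝ) (Ω : Set (EuclideanSpace ℝ (Fin N))) : ℝ≥0∞ :=
  sInf {E : ℝ≥0∞ | ∃ (u : EuclideanSpace ℝ (Fin N) → ℝ)
    (G : EuclideanSpace ℝ (Fin N) → EuclideanSpace ℝ (Fin N)),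
    MemD0 Ω u ∧ HasWeakGradient u G ∧
    eLpNorm u (ENNReal.ofReal q) (volume.restrict Ω) = 1 ∧ E = ∫⁻ x in Ω, ‖G x‖ₑ ^ 2}

/-- The Sobolev exponent `2^*`, equal to `2N / (N - 2)` for `N ≥ 3` and to `∞` for `N = 2`. -/
def sobolevExponent (N : ℕ) : ℝ≥0∞ :=
  if 3 ≤ N then ENNReal.ofReal (2 * (N : ℝ) / ((N : ℝ) - 2)) else ⊤

/-- `ω_N`, the volume of the unit ball of `ℝ^N`. -/
def unitBallVolume (N : ℕ) : ℝ≥0∞ :=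
  volume (Metric.ball (0 : EuclideanSpace ℝ (Fin N)) 1)

/-- `Ω` has Lipschitz boundary: near each boundary point, `Ω` is the region lying below the graph,
in the direction of some unit vector `e`, of a Lipschitz function `g` of the component of the
point orthogonal to `e` (only the values of `g` on the hyperplane orthogonal to `e` matter). -/
def HasLipschitzBoundary {N : ℕ} (Ω : Set (EuclideanSpace ℝ (Fin N))) : Prop :=
  ∀ x₀ ∈ frontier Ω, ∃ r > 0, ∃ e : EuclideanSpace ℝ (Fin N), ‖e‖ = 1 ∧
    ∃ (K : NNReal) (g : EuclideanSpace ℝ (Fin N) → ℝ), LipschitzWith K g ∧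
      ∀ x ∈ Metric.ball x₀ r, x ∈ Ω ↔ inner ℝ e x < g (x - (inner ℝ e x : ℝ) • e)

end

/-! ### Radial integrals in polar coordinates. -/

section Radial

variable {V : Type*} [NormedAddCommGroup V] [InnerProductSpace ℝ V] [FiniteDimensional ℝ V]
  [MeasurableSpace V] [BorelSpace V]

/-! Everything is done with the Fourier transform on test functions. By Plancherel and Tonelli, the
squared Gagliardo seminorm of a test function is the integral of $|\hat u|^2$ against a symbol
which, being rotation invariant and homogeneous, equals $k_s|\xi|^{2s}$ with $k_s$ its value at any
unit vector. Averaging over an orthonormal basis and the second order expansion of the cosine give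
$(1-s)k_s\to 2\pi^2\omega_N$ (`tendsto_mul_fracSymbol`). Since $\int|\nabla
u|^2=4\pi^2\int|\xi|^2|\hat u|^2$, each fixed test function satisfies
$(1-s)[u]^2\to\frac{\omega_N}{2}\int|\nabla u|^2$ (`IsTestFunction.tendsto_gagliardoSq`).
Competitors in the completions can be replaced by test functions of almost the same energy and, by
Fatou, almost no smaller $L^q$ norm. Testing the fractional problems with one fixed function then
gives the upper bound.

For the lower bound, a test function $u$ on $\Omega$ with $(1-s)[u]^2\le M^2$ must be turned into a
test function $v$ on $\Omega$ with $\frac{\omega_N}{2}\int|\nabla v|^2\le(1+\tau)M^2$ and nearly the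
same $L^q$ norm, uniformly in $u$ (`InwardPartition.eventually_exists_testFunction`). Convolution
with a fixed mollifier bounds the energy of order $1$ by that of order $s$ with a constant
$C^{2(1-s)}\to1$ (`exists_fracEnergy_one_mollify_le`), but enlarges the support. In a Lipschitz
domain this is repaired by translating the mollified function inward by $\varepsilon$ in each chart
and gluing with a partition of unity. A translated mollification differs from $u$ by a Fourier
multiplier that is small at low frequencies, so at every order below $s$ the difference costs a
positive power of $\varepsilon$ (`fracEnergy_mollify_translate_sub_le`). At order $0$ this controls
the terms where the gradient falls on the partition; at a fixed order $\sigma<1$ for which $q$ is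
still subcritical, it controls the $L^q$ error through a Sobolev inequality whose constant does not
depend on $s$ (`exists_eLpNorm_le_fracEnergy`). The displacement $\varepsilon$ and the mollifier are
fixed first, and only then does $s$ tend to $1$; no compactness of sequences of functions is needed.
-/

theorem lintegral_comp_norm [Nontrivial V] {f : ℝ → ℝ≥0∞} (hf : Measurable f) :
    ∫⁻ x : V, f ‖x‖ = Module.finrank ℝ V * volume (Metric.ball (0 : V) 1) *
      ∫⁻ y in Ioi (0 : ℝ), ENNReal.ofReal (y ^ (Module.finrank ℝ V - 1)) * f y := by
  have h1 : Measurable fun p : Metric.sphere (0 : V) 1 × Ioi (0 : ℝ) => f p.2 :=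
    hf.comp (measurable_subtype_coe.comp measurable_snd)
  have h2 : Measurable fun x : Ioi (0 : ℝ) => f x := hf.comp measurable_subtype_coe
  calc
    ∫⁻ x : V, f ‖x‖ = ∫⁻ x : ({(0)}ᶜ : Set V), f (‖x.1‖) ∂(volume.comap Subtype.val) := by
      rw [lintegral_subtype_comap (measurableSet_singleton _).compl fun x ↦ f (‖x‖),
        restrict_compl_singleton]
    _ = ∫⁻ x, f x.2 ∂((volume : Measure V).toSphere.prod
          (.volumeIoiPow (Module.finrank ℝ V - 1))) := by
      simpa using (volume : Measure V).measurePreserving_homeomorphUnitSphereProd.lintegral_comp h1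
    _ = (volume : Measure V).toSphere univ *
          ∫⁻ x : Ioi (0 : ℝ), f x ∂.volumeIoiPow (Module.finrank ℝ V - 1) := by
      rw [lintegral_prod _ h1.aemeasurable]
      simp [mul_comm]
    _ = _ := by
      rw [Measure.volumeIoiPow, lintegral_withDensity_eq_lintegral_mul _
        (by fun_prop) h2, Measure.toSphere_apply_univ]
      congr 1
      rw [← lintegral_subtype_comap measurableSet_Ioi]
      rfl

theorem lintegral_ball_norm_rpow [Nontrivial V] {a R : ℝ} (ha : 0 < Module.finrank ℝ V + a)
    (hR : 0 < R) :
    ∫⁻ x in Metric.ball (0 : V) R, ENNReal.ofReal (‖x‖ ^ a) =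
      ENNReal.ofReal (Module.finrank ℝ V * R ^ (Module.finrank ℝ V + a) /
        (Module.finrank ℝ V + a)) * volume (Metric.ball (0 : V) 1) := by
  set d := Module.finrank ℝ V with hd
  have hd1 : 1 ≤ d := Module.finrank_pos
  have h1 : ∫⁻ x in Metric.ball (0 : V) R, ENNReal.ofReal (‖x‖ ^ a) =
      ∫⁻ x : V, (Iio R).indicator (fun r => ENNReal.ofReal (r ^ a)) ‖x‖ := by
    rw [← lintegral_indicator Metric.isOpen_ball.measurableSet]
    congr 1 with x
    simp [indicator]
  rw [h1, lintegral_comp_norm ((by fun_prop : Measurable fun r : ℝ =>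
    ENNReal.ofReal (r ^ a)).indicator measurableSet_Iio)]
  have h2 : ∫⁻ y in Ioi (0 : ℝ), ENNReal.ofReal (y ^ (d - 1)) *
      (Iio R).indicator (fun r => ENNReal.ofReal (r ^ a)) y =
      ∫⁻ y in Ioc (0 : ℝ) R, ENNReal.ofReal (y ^ (d - 1 + a)) := by
    rw [← restrict_Ioo_eq_restrict_Ioc, ← lintegral_indicator measurableSet_Ioi,
      ← lintegral_indicator measurableSet_Ioo]
    congr 1 with y
    by_cases h0 : 0 < y <;> by_cases hy : y < R <;> simp [h0, hy]
    rw [← ENNReal.ofReal_mul (by positivity), ← Real.rpow_natCast, ← Real.rpow_add h0]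
    simp [Nat.cast_sub hd1]
  rw [h2, ← ofReal_integral_eq_lintegral_ofReal]
  · rw [← intervalIntegral.integral_of_le hR.le, integral_rpow (Or.inl (by linarith)),
      Real.zero_rpow (by linarith), mul_right_comm]
    congr 1
    rw [← ENNReal.ofReal_natCast, ← ENNReal.ofReal_mul (by positivity)]
    congr 1
    rw [show (d : ℝ) - 1 + a + 1 = d + a by ring]
    ring
  · exact (intervalIntegrable_iff_integrableOn_Ioc_of_le hR.le).1
      (intervalIntegral.intervalIntegrable_rpow' (by linarith))
  · exact (ae_restrict_mem measurableSet_Ioc).mono fun y hy => Real.rpow_nonneg hy.1.le _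

theorem lintegral_compl_ball_norm_rpow [Nontrivial V] {a : ℝ} (ha : Module.finrank ℝ V + a < 0) :
    ∫⁻ x in (Metric.ball (0 : V) 1)ᶜ, ENNReal.ofReal (‖x‖ ^ a) =
      ENNReal.ofReal (Module.finrank ℝ V / (-(Module.finrank ℝ V + a))) *
        volume (Metric.ball (0 : V) 1) := by
  set d := Module.finrank ℝ V with hd
  have hd1 : 1 ≤ d := Module.finrank_pos
  have h1 : ∫⁻ x in (Metric.ball (0 : V) 1)ᶜ, ENNReal.ofReal (‖x‖ ^ a) =
      ∫⁻ x : V, (Ici 1).indicator (fun r => ENNReal.ofReal (r ^ a)) ‖x‖ := by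
    rw [← lintegral_indicator Metric.isOpen_ball.measurableSet.compl]
    congr 1 with x
    simp [indicator]
  rw [h1, lintegral_comp_norm ((by fun_prop : Measurable fun r : ℝ =>
    ENNReal.ofReal (r ^ a)).indicator measurableSet_Ici)]
  have h2 : ∫⁻ y in Ioi (0 : ℝ), ENNReal.ofReal (y ^ (d - 1)) *
      (Ici 1).indicator (fun r => ENNReal.ofReal (r ^ a)) y =
      ∫⁻ y in Ioi (1 : ℝ), ENNReal.ofReal (y ^ (d - 1 + a)) := by
    rw [restrict_Ioi_eq_restrict_Ici (a := (1 : ℝ)), ← lintegral_indicator measurableSet_Ioi,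
      ← lintegral_indicator measurableSet_Ici]
    congr 1 with y
    by_cases hy : 1 ≤ y
    · have h0 : 0 < y := by linarith
      simp only [mem_Ioi, h0, indicator_of_mem, mem_Ici, hy]
      rw [← ENNReal.ofReal_mul (by positivity), ← Real.rpow_natCast, ← Real.rpow_add h0]
      simp [Nat.cast_sub hd1]
    · by_cases h0 : 0 < y <;> simp [h0, hy]
  rw [h2, ← ofReal_integral_eq_lintegral_ofReal]
  · rw [integral_Ioi_rpow_of_lt (by linarith) one_pos, Real.one_rpow, mul_right_comm]
    congr 1
    rw [← ENNReal.ofReal_natCast, ← ENNReal.ofReal_mul (by positivity)]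
    congr 1
    rw [show (d : ℝ) - 1 + a + 1 = d + a by ring]
    rw [div_neg, neg_div]; ring
  · exact integrableOn_Ioi_rpow_of_lt (by linarith) one_pos
  · exact (ae_restrict_mem measurableSet_Ioi).mono fun y hy =>
      Real.rpow_nonneg (zero_le_one.trans (le_of_lt hy)) _

end Radial

/-! ### The Fourier symbol of the Gagliardo seminorm and its asymptotics as $s\nearrow1$. -/

section Symbol

/-- Parseval for the basis. Summing over basis directions replaces the anisotropic quadratic form
$\langle h,\xi\rangle^2$ by the radial function $|h|^2$, so that the symbol can be estimated with
radial integrals only. -/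
theorem sum_inner_sq_div {V : Type*} [NormedAddCommGroup V] [InnerProductSpace ℝ V] (s : ℝ) {h : V} (hh : h ≠ 0)
    (b : OrthonormalBasis (Fin (Module.finrank ℝ V)) ℝ V) {c : ℝ} (hc : 0 ≤ c) :
    ∑ i, ENNReal.ofReal (c * (2 * Real.pi * inner ℝ h (b i)) ^ 2 /
      ‖h‖ ^ ((Module.finrank ℝ V : ℝ) + 2 * s)) =
    ENNReal.ofReal (4 * Real.pi ^ 2 * c) *
      ENNReal.ofReal (‖h‖ ^ (2 - (Module.finrank ℝ V : ℝ) - 2 * s)) := by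
  have h0 : 0 < ‖h‖ := norm_pos_iff.2 hh
  rw [← ENNReal.ofReal_sum_of_nonneg (fun i _ => by positivity),
    ← ENNReal.ofReal_mul (by positivity)]
  congr 1
  have h1 : ∑ i, (inner ℝ h (b i)) ^ 2 = ‖h‖ ^ 2 := by
    simpa using b.sum_sq_norm_inner_left h
  rw [show 2 - (Module.finrank ℝ V : ℝ) - 2 * s = 2 - ((Module.finrank ℝ V : ℝ) + 2 * s) by ring,
    Real.rpow_sub h0, ← Finset.sum_div]
  have : ∑ i, c * (2 * Real.pi * inner ℝ h (b i)) ^ 2 = 4 * Real.pi ^ 2 * c * ‖h‖ ^ 2 := by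
    rw [← h1, Finset.mul_sum]
    exact Finset.sum_congr rfl fun i _ => by ring
  rw [this]
  norm_num
  ring

variable {V : Type*} [NormedAddCommGroup V] [InnerProductSpace ℝ V] [FiniteDimensional ℝ V]
  [MeasurableSpace V] [BorelSpace V]

/-- The Fourier symbol of the squared Gagliardo seminorm:
`∫ |e^{2πi⟨h,ξ⟩} - 1|² / |h|^{d + 2s} dh`. -/
noncomputable def fracSymbol (s : ℝ) (ξ : V) : ℝ≥0∞ :=
  ∫⁻ h : V, ENNReal.ofReal ((2 - 2 * Real.cos (2 * Real.pi * inner ℝ h ξ)) /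
    ‖h‖ ^ ((Module.finrank ℝ V : ℝ) + 2 * s))

theorem fracSymbol_linearIsometryEquiv (s : ℝ) (R : V ≃ₗᵢ[ℝ] V) (ξ : V) :
    fracSymbol s (R ξ) = fracSymbol s ξ := by
  unfold fracSymbol
  rw [← R.measurePreserving.lintegral_comp_emb R.toHomeomorph.measurableEmbedding]
  simp

theorem lintegral_comp_inv_smul {f : V → ℝ≥0∞} {t : ℝ} (ht : 0 < t) :
    ∫⁻ x : V, f (t⁻¹ • x) = ENNReal.ofReal (t ^ Module.finrank ℝ V) * ∫⁻ x : V, f x := by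
  have h := (Homeomorph.smulOfNeZero t⁻¹ (inv_ne_zero ht.ne') : V ≃ₜ V).measurableEmbedding
  have h2 := h.lintegral_map (μ := volume) f
  have h3 : Measure.map (Homeomorph.smulOfNeZero t⁻¹ (inv_ne_zero ht.ne') : V ≃ₜ V) volume
      = ENNReal.ofReal (t ^ Module.finrank ℝ V) • (volume : Measure V) := by
    have := Measure.map_addHaar_smul (volume : Measure V) (inv_ne_zero ht.ne')
    rw [show ⇑(Homeomorph.smulOfNeZero t⁻¹ (inv_ne_zero ht.ne') : V ≃ₜ V) = (t⁻¹ • ·) from rfl,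
      this, inv_pow, inv_inv, abs_of_pos (by positivity)]
  rw [h3, lintegral_smul_measure] at h2
  exact h2.symm

theorem fracSymbol_smul (s : ℝ) {t : ℝ} (ht : 0 < t) (ξ : V) :
    fracSymbol s (t • ξ) = ENNReal.ofReal (t ^ (2 * s)) * fracSymbol s ξ := by
  have h1 : fracSymbol s (t • ξ) = ENNReal.ofReal (t ^ (-(Module.finrank ℝ V : ℝ))) *
      ∫⁻ h : V, ENNReal.ofReal ((2 - 2 * Real.cos (2 * Real.pi * inner ℝ (t⁻¹ • h) (t • ξ))) /
        ‖t⁻¹ • h‖ ^ ((Module.finrank ℝ V : ℝ) + 2 * s)) := by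
    rw [lintegral_comp_inv_smul (f := fun h : V => ENNReal.ofReal
      ((2 - 2 * Real.cos (2 * Real.pi * inner ℝ h (t • ξ))) /
        ‖h‖ ^ ((Module.finrank ℝ V : ℝ) + 2 * s))) ht, ← mul_assoc,
      ← ENNReal.ofReal_mul (by positivity), ← Real.rpow_natCast, ← Real.rpow_add ht]
    simp [fracSymbol]
  have h2 : ∀ h : V, ENNReal.ofReal ((2 - 2 * Real.cos
        (2 * Real.pi * inner ℝ (t⁻¹ • h) (t • ξ))) /
        ‖t⁻¹ • h‖ ^ ((Module.finrank ℝ V : ℝ) + 2 * s)) =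
      ENNReal.ofReal (t ^ ((Module.finrank ℝ V : ℝ) + 2 * s)) *
      ENNReal.ofReal ((2 - 2 * Real.cos (2 * Real.pi * inner ℝ h ξ)) /
    ‖h‖ ^ ((Module.finrank ℝ V : ℝ) + 2 * s)) := by
    intro h
    rw [← ENNReal.ofReal_mul (by positivity), real_inner_smul_left, real_inner_smul_right,
      inv_mul_cancel_left₀ ht.ne', norm_smul, norm_inv, Real.norm_of_nonneg ht.le,
      Real.mul_rpow (by positivity) (norm_nonneg _), Real.inv_rpow ht.le]
    congr 1
    rw [div_mul_eq_div_div, div_inv_eq_mul]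
    ring
  simp_rw [h1, h2]
  rw [lintegral_const_mul' _ _ ENNReal.ofReal_ne_top, ← mul_assoc,
    ← ENNReal.ofReal_mul (by positivity), ← Real.rpow_add ht, neg_add_cancel_left]
  rfl

/-- Two vectors of equal length are exchanged by a reflection, which leaves the symbol invariant. -/
theorem fracSymbol_eq_of_norm_eq (s : ℝ) {ξ ζ : V} (h : ‖ξ‖ = ‖ζ‖) :
    fracSymbol s ξ = fracSymbol s ζ := by
  rw [← Submodule.reflection_sub h, fracSymbol_linearIsometryEquiv]

theorem fracSymbol_eq {s : ℝ} (hs : 0 < s) {e : V} (he : ‖e‖ = 1) (ξ : V) :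
    fracSymbol s ξ = ENNReal.ofReal (‖ξ‖ ^ (2 * s)) * fracSymbol s e := by
  rcases eq_or_ne ξ 0 with rfl | h
  · simp [fracSymbol, Real.zero_rpow (by linarith : 2 * s ≠ 0)]
  · rw [← fracSymbol_smul s (norm_pos_iff.2 h)]
    exact fracSymbol_eq_of_norm_eq s (by simp [norm_smul, he])

theorem ae_ne_zero [Nontrivial V] : ∀ᵐ h : V, h ≠ 0 := by
  simp [ae_iff]

/-- By isotropy, $d$ times the value at $e$ is the sum of the values over an orthonormal basis.
Inside the unit ball $2-2\cos\theta\le\theta^2$ and the sum is radial; outside, $2-2\cos\theta\le4$.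
Only the first part is singular as $s\nearrow1$. -/
theorem fracSymbol_upper [Nontrivial V] {s : ℝ} (hs : 0 < s) (hs1 : s < 1) {e : V}
    (he : ‖e‖ = 1) :
    fracSymbol s e ≤ ENNReal.ofReal (2 * Real.pi ^ 2 / (1 - s) +
      2 * (Module.finrank ℝ V) / s) * volume (Metric.ball (0 : V) 1) := by
  set d := Module.finrank ℝ V with hd
  have hd1 : 0 < (d : ℝ) := Nat.cast_pos.2 Module.finrank_pos
  set b := stdOrthonormalBasis ℝ V
  have hsum : d * fracSymbol s e = ∑ i, fracSymbol s (b i) := by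
    rw [Finset.sum_congr rfl fun i _ => fracSymbol_eq_of_norm_eq s
      ((b.norm_eq_one i).trans he.symm)]
    simp [hd]
  have key : ∀ i, fracSymbol s (b i) ≤
      (∫⁻ h in Metric.ball (0 : V) 1, ENNReal.ofReal (1 * (2 * Real.pi * inner ℝ h (b i)) ^ 2 /
        ‖h‖ ^ ((d : ℝ) + 2 * s))) +
      ∫⁻ h in (Metric.ball (0 : V) 1)ᶜ, 4 * ENNReal.ofReal (‖h‖ ^ (-(d : ℝ) - 2 * s)) := by
    intro i
    rw [fracSymbol, ← lintegral_add_compl _ Metric.isOpen_ball.measurableSet]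
    refine add_le_add (lintegral_mono fun h => ?_) (lintegral_mono fun h => ?_)
    · apply ENNReal.ofReal_le_ofReal
      gcongr
      have := Real.one_sub_sq_div_two_le_cos (x := 2 * Real.pi * inner ℝ h (b i))
      linarith
    · rw [show (4 : ℝ≥0∞) = ENNReal.ofReal 4 by norm_num, ← ENNReal.ofReal_mul (by norm_num)]
      apply ENNReal.ofReal_le_ofReal
      rw [show -(d : ℝ) - 2 * s = -((d : ℝ) + 2 * s) by ring, Real.rpow_neg (norm_nonneg _),
        ← div_eq_mul_inv]
      gcongr
      have := Real.neg_one_le_cos (2 * Real.pi * inner ℝ h (b i))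
      linarith
  have hd0 : (d : ℝ≥0∞) ≠ 0 := by simpa [hd] using Module.finrank_pos.ne'
  rw [← ENNReal.mul_le_mul_iff_right hd0 (ENNReal.natCast_ne_top d), hsum]
  refine (Finset.sum_le_sum fun i _ => key i).trans ?_
  rw [Finset.sum_add_distrib, ← lintegral_finsetSum _ (fun i _ => by fun_prop)]
  have e1 : ∫⁻ h in Metric.ball (0 : V) 1, ∑ i, ENNReal.ofReal
      (1 * (2 * Real.pi * inner ℝ h (b i)) ^ 2 / ‖h‖ ^ ((d : ℝ) + 2 * s)) =
      ∫⁻ h in Metric.ball (0 : V) 1, ENNReal.ofReal (4 * Real.pi ^ 2 * 1) *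
        ENNReal.ofReal (‖h‖ ^ (2 - (d : ℝ) - 2 * s)) :=
    lintegral_congr_ae <| ae_restrict_of_ae <| ae_ne_zero.mono fun h hh =>
      sum_inner_sq_div s hh b zero_le_one
  have hlt : (Module.finrank ℝ V : ℝ) + (-(d : ℝ) - 2 * s) < 0 := by linarith
  have hgt : 0 < (Module.finrank ℝ V : ℝ) + (2 - (d : ℝ) - 2 * s) := by linarith
  rw [e1, lintegral_const_mul' _ _ ENNReal.ofReal_ne_top, lintegral_ball_norm_rpow hgt one_pos,
    lintegral_const_mul' _ _ (by norm_num), lintegral_compl_ball_norm_rpow hlt]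
  simp only [Finset.sum_const, Finset.card_univ, Fintype.card_fin, nsmul_eq_mul, ← mul_assoc,
    ← hd, ← add_mul]
  gcongr
  rw [show (4 : ℝ≥0∞) = ENNReal.ofReal 4 by norm_num, ← ENNReal.ofReal_natCast,
    ← ENNReal.ofReal_mul (by positivity), ← ENNReal.ofReal_mul (by positivity),
    ← ENNReal.ofReal_mul (by positivity), ← ENNReal.ofReal_mul (by positivity),
    ← ENNReal.ofReal_add (by rw [Real.one_rpow]; have := hgt.le; positivity)
      (by rw [neg_add]; ring_nf; positivity)]
  apply ENNReal.ofReal_le_ofReal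
  rw [Real.one_rpow, show (d : ℝ) + (2 - d - 2 * s) = 2 * (1 - s) by ring,
    show -((d : ℝ) + (-d - 2 * s)) = 2 * s by ring]
  have : 1 - s ≠ 0 := by linarith
  apply le_of_eq
  field_simp
  ring

/-- Only the ball of radius $\rho$ is kept, where the cosine is close to its quadratic expansion.
The free radius $\rho$ is later sent to $0$ together with $1-s$. -/
theorem fracSymbol_lower [Nontrivial V] {s ρ : ℝ} (hs1 : s < 1) {e : V}
    (he : ‖e‖ = 1) (hρ : 0 < ρ) (hρ1 : 2 * Real.pi * ρ ≤ 1) :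
    ENNReal.ofReal (2 * Real.pi ^ 2 * (1 - 5 * ρ ^ 2) * ρ ^ (2 * (1 - s)) / (1 - s)) *
      volume (Metric.ball (0 : V) 1) ≤ fracSymbol s e := by
  set d := Module.finrank ℝ V with hd
  have hd1 : 0 < (d : ℝ) := Nat.cast_pos.2 Module.finrank_pos
  set b := stdOrthonormalBasis ℝ V
  have hsum : d * fracSymbol s e = ∑ i, fracSymbol s (b i) := by
    rw [Finset.sum_congr rfl fun i _ => fracSymbol_eq_of_norm_eq s
      ((b.norm_eq_one i).trans he.symm)]
    simp [hd]
  have hpi := Real.pi_gt_three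
  have hpi' : Real.pi ^ 2 < 10 := by nlinarith [Real.pi_lt_d2, Real.pi_pos]
  have hc : 0 ≤ 1 - 5 * ρ ^ 2 := by nlinarith
  have key : ∀ i, (∫⁻ h in Metric.ball (0 : V) ρ,
      ENNReal.ofReal ((1 - 5 * ρ ^ 2) * (2 * Real.pi * inner ℝ h (b i)) ^ 2 /
        ‖h‖ ^ ((d : ℝ) + 2 * s))) ≤ fracSymbol s (b i) := by
    intro i
    rw [fracSymbol]
    refine le_trans ?_ (setLIntegral_le_lintegral (Metric.ball (0 : V) ρ) _)
    refine setLIntegral_mono' Metric.isOpen_ball.measurableSet fun h hh => ?_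
    apply ENNReal.ofReal_le_ofReal
    gcongr
    set θ := 2 * Real.pi * inner ℝ h (b i) with hθ
    have h1 : |inner ℝ h (b i)| ≤ ρ := by
      have := abs_real_inner_le_norm h (b i)
      rw [b.norm_eq_one, mul_one] at this
      exact this.trans (mem_ball_zero_iff.1 hh).le
    have h2 : |θ| ≤ 2 * Real.pi * ρ := by
      rw [hθ, abs_mul, abs_of_pos (by positivity)]
      gcongr
    have h3 := (abs_le.1 (Real.cos_bound (h2.trans hρ1))).2
    -- The quartic remainder gives $2-2\cos\theta\ge\theta^2-\frac{5}{48}\theta^4$. With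
    -- $\theta^2\le4\pi^2\rho^2\le40\rho^2$ the relative loss is at most
    -- $\frac{200}{48}\rho^2\le5\rho^2$.
    have h4 : |θ| ^ 2 ≤ (2 * Real.pi * ρ) ^ 2 := by gcongr
    rw [sq_abs] at h4
    have h5 : |θ| ^ 4 = θ ^ 2 * θ ^ 2 := by rw [← sq_abs θ]; ring
    rw [h5] at h3
    have h6 : θ ^ 2 * θ ^ 2 ≤ (2 * Real.pi * ρ) ^ 2 * θ ^ 2 :=
      mul_le_mul_of_nonneg_right h4 (sq_nonneg _)
    have h7 : (2 * Real.pi * ρ) ^ 2 * θ ^ 2 ≤ 40 * (ρ ^ 2 * θ ^ 2) := by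
      have : 0 ≤ ρ ^ 2 * θ ^ 2 := by positivity
      nlinarith
    linarith [mul_nonneg (sq_nonneg ρ) (sq_nonneg θ)]
  have hd0 : (d : ℝ≥0∞) ≠ 0 := by simpa [hd] using Module.finrank_pos.ne'
  rw [← ENNReal.mul_le_mul_iff_right hd0 (ENNReal.natCast_ne_top d), hsum]
  refine le_trans ?_ (Finset.sum_le_sum fun i _ => key i)
  rw [← lintegral_finsetSum _ (fun i _ => by fun_prop)]
  have e1 : ∫⁻ h in Metric.ball (0 : V) ρ, ∑ i, ENNReal.ofReal
      ((1 - 5 * ρ ^ 2) * (2 * Real.pi * inner ℝ h (b i)) ^ 2 / ‖h‖ ^ ((d : ℝ) + 2 * s)) =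
      ∫⁻ h in Metric.ball (0 : V) ρ, ENNReal.ofReal (4 * Real.pi ^ 2 * (1 - 5 * ρ ^ 2)) *
        ENNReal.ofReal (‖h‖ ^ (2 - (d : ℝ) - 2 * s)) :=
    lintegral_congr_ae <| ae_restrict_of_ae <| ae_ne_zero.mono fun h hh =>
      sum_inner_sq_div s hh b hc
  have hgt : 0 < (Module.finrank ℝ V : ℝ) + (2 - (d : ℝ) - 2 * s) := by linarith
  rw [e1, lintegral_const_mul' _ _ ENNReal.ofReal_ne_top, lintegral_ball_norm_rpow hgt hρ,
    ← mul_assoc, ← mul_assoc, ← ENNReal.ofReal_natCast, ← ENNReal.ofReal_mul (by positivity),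
    ← ENNReal.ofReal_mul (by positivity)]
  refine mul_le_mul' (ENNReal.ofReal_le_ofReal ?_) le_rfl
  rw [← hd, show (d : ℝ) + (2 - d - 2 * s) = 2 * (1 - s) by ring]
  have : 1 - s ≠ 0 := by linarith
  apply le_of_eq
  field_simp
  ring

theorem tendsto_mul_fracSymbol [Nontrivial V] {e : V} (he : ‖e‖ = 1) :
    Tendsto (fun s : ℝ => ENNReal.ofReal (1 - s) * fracSymbol s e) (𝓝[<] 1)
      (𝓝 (ENNReal.ofReal (2 * Real.pi ^ 2) * volume (Metric.ball (0 : V) 1))) := by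
  have hb : volume (Metric.ball (0 : V) 1) ≠ ⊤ := measure_ball_lt_top.ne
  have h01 : ∀ᶠ s : ℝ in 𝓝[<] 1, 0 < s ∧ s < 1 ∧ 2 * Real.pi * (1 - s) ≤ 1 := by
    have h : ∀ᶠ s : ℝ in 𝓝[<] 1, 1 - 1 / (2 * Real.pi) < s :=
      mem_nhdsWithin_of_mem_nhds (lt_mem_nhds (sub_lt_self 1 (by positivity)))
    filter_upwards [h, self_mem_nhdsWithin, mem_nhdsWithin_of_mem_nhds (lt_mem_nhds one_pos)]
      with s h1 h2 h3
    refine ⟨h3, h2, ?_⟩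
    have : 1 - s < 1 / (2 * Real.pi) := by linarith
    rw [lt_div_iff₀ (by positivity)] at this
    linarith
  -- Squeeze, with $\rho=1-s$ in the lower bound: $\rho^{2(1-s)}=\exp(2(1-s)\log(1-s))\to1$ because
  -- $x\log x$ is continuous at $0$.
  refine tendsto_of_tendsto_of_tendsto_of_le_of_le'
    (g := fun s => ENNReal.ofReal (2 * Real.pi ^ 2 * (1 - 5 * (1 - s) ^ 2) *
      Real.exp (2 * ((1 - s) * Real.log (1 - s)))) * volume (Metric.ball (0 : V) 1))
    (h := fun s => ENNReal.ofReal (2 * Real.pi ^ 2 + (1 - s) * (2 * (Module.finrank ℝ V) / s))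
      * volume (Metric.ball (0 : V) 1)) ?_ ?_ ?_ ?_
  · refine ENNReal.Tendsto.mul_const (ENNReal.tendsto_ofReal ?_) (Or.inr hb)
    have hc : Continuous fun s : ℝ => 2 * Real.pi ^ 2 * (1 - 5 * (1 - s) ^ 2) *
        Real.exp (2 * ((1 - s) * Real.log (1 - s))) := by
      have := Real.continuous_mul_log.comp (continuous_const.sub continuous_id : Continuous
        fun s : ℝ => 1 - s)
      have h' : Continuous fun s : ℝ => (1 - s) * Real.log (1 - s) := this
      fun_prop
    have := (hc.tendsto 1).mono_left (nhdsWithin_le_nhds (s := Iio 1))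
    simpa using this
  · refine ENNReal.Tendsto.mul_const (ENNReal.tendsto_ofReal ?_) (Or.inr hb)
    have hc : ContinuousAt (fun s : ℝ => 2 * Real.pi ^ 2 + (1 - s) *
        (2 * (Module.finrank ℝ V) / s)) 1 := by fun_prop (disch := norm_num)
    have := hc.tendsto.mono_left (nhdsWithin_le_nhds (s := Iio 1))
    simpa using this
  · filter_upwards [h01] with s ⟨h0, h1, h2⟩
    have h3 : 0 < 1 - s := by linarith
    refine le_trans (le_of_eq ?_) (mul_le_mul_right (fracSymbol_lower h1 he h3 h2) _)
    rw [← mul_assoc (ENNReal.ofReal (1 - s)), ← ENNReal.ofReal_mul h3.le, Real.rpow_def_of_pos h3]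
    congr 2
    field_simp
  · filter_upwards [h01] with s ⟨h0, h1, h2⟩
    have h3 : 0 < 1 - s := by linarith
    refine (mul_le_mul_right (fracSymbol_upper h0 h1 he) _).trans (le_of_eq ?_)
    rw [← mul_assoc, ← ENNReal.ofReal_mul h3.le]
    congr 2
    field_simp

end Symbol

open scoped FourierTransform

/-! ### Test functions -/

section TestFunctions

variable {N : ℕ} {Ω : Set (EuclideanSpace ℝ (Fin N))} {u v : EuclideanSpace ℝ (Fin N) → ℝ}

theorem isTestFunction_univ_iff : IsTestFunction univ u ↔ ContDiff ℝ ∞ u ∧ HasCompactSupport u :=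
  ⟨fun h => ⟨h.smooth, h.compact⟩, fun h => ⟨h.1, h.2, subset_univ _⟩⟩

theorem IsTestFunction.mono {Ω' : Set (EuclideanSpace ℝ (Fin N))} (h : IsTestFunction Ω u)
    (hΩ : Ω ⊆ Ω') : IsTestFunction Ω' u :=
  ⟨h.smooth, h.compact, h.support.trans hΩ⟩

theorem IsTestFunction.to_univ (h : IsTestFunction Ω u) : IsTestFunction univ u :=
  h.mono (subset_univ _)

theorem IsTestFunction.sub (hu : IsTestFunction Ω u) (hv : IsTestFunction Ω v) :
    IsTestFunction Ω (fun x => u x - v x) where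
  smooth := hu.smooth.sub hv.smooth
  compact := hu.compact.sub hv.compact
  support := (tsupport_sub u v).trans (union_subset hu.support hv.support)

theorem IsTestFunction.const_mul (hu : IsTestFunction Ω u) (c : ℝ) :
    IsTestFunction Ω (fun x => c * u x) where
  smooth := contDiff_const.mul hu.smooth
  compact := hu.compact.mul_left
  support := (tsupport_mul_subset_right (f := fun _ => c)).trans hu.support

theorem IsTestFunction.comp_add_right (hu : IsTestFunction univ u)
    (h : EuclideanSpace ℝ (Fin N)) : IsTestFunction univ (fun x => u (x + h)) :=
  isTestFunction_univ_iff.2 ⟨hu.smooth.comp (contDiff_id.add contDiff_const),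
    hu.compact.comp_homeomorph (Homeomorph.addRight h)⟩

theorem IsTestFunction.fderiv_apply (hu : IsTestFunction univ u)
    (v : EuclideanSpace ℝ (Fin N)) : IsTestFunction univ (fun x => fderiv ℝ u x v) :=
  isTestFunction_univ_iff.2 ⟨(hu.smooth.fderiv_right (m := ∞) (by simp)).clm_apply contDiff_const,
    hu.compact.fderiv_apply ℝ v⟩

theorem IsTestFunction.continuous (hu : IsTestFunction Ω u) : Continuous u := hu.smooth.continuous

theorem IsTestFunction.integrable (hu : IsTestFunction Ω u) : Integrable u :=
  hu.continuous.integrable_of_hasCompactSupport hu.compact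

/-- A test function as a complex Schwartz function. -/
noncomputable def IsTestFunction.toSchwartz (hu : IsTestFunction Ω u) :
    SchwartzMap (EuclideanSpace ℝ (Fin N)) ℂ :=
  HasCompactSupport.toSchwartzMap (f := fun x => (u x : ℂ))
    (hu.compact.comp_left (g := fun r : ℝ => (r : ℂ)) rfl)
    (Complex.ofRealCLM.contDiff.comp hu.smooth)

@[simp]
theorem IsTestFunction.coe_toSchwartz (hu : IsTestFunction Ω u) :
    (hu.toSchwartz : EuclideanSpace ℝ (Fin N) → ℂ) = fun x => (u x : ℂ) := rfl

end TestFunctions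

/-! ### Fourier transform of test functions -/

section Fourier

theorem enorm_complex_ofReal (r : ℝ) : ‖(r : ℂ)‖ₑ = ‖r‖ₑ := by
  rw [← ofReal_norm, ← ofReal_norm, Complex.norm_real]

theorem lintegral_enorm_sq_fourier {V : Type*} [NormedAddCommGroup V] [InnerProductSpace ℝ V]
    [FiniteDimensional ℝ V] [MeasurableSpace V] [BorelSpace V] (f : SchwartzMap V ℂ) :
    ∫⁻ ξ, ‖𝓕 (f : V → ℂ) ξ‖ₑ ^ 2 = ∫⁻ x, ‖f x‖ₑ ^ 2 := by
  have key : ∀ g : SchwartzMap V ℂ, ∫⁻ x, ‖g x‖ₑ ^ 2 = ENNReal.ofReal (∫ x, ‖g x‖ ^ 2) := by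
    intro g
    rw [ofReal_integral_eq_lintegral_ofReal _ (ae_of_all _ fun x => by positivity)]
    · simp [ENNReal.ofReal_pow, ofReal_norm]
    · simpa using (g.memLp 2).integrable_norm_pow (by norm_num)
  rw [← SchwartzMap.fourier_coe, key, key, SchwartzMap.integral_norm_sq_fourier]

/-- The Fourier transform of a real function. -/
noncomputable def fourierReal {N : ℕ} (u : EuclideanSpace ℝ (Fin N) → ℝ) :
    EuclideanSpace ℝ (Fin N) → ℂ :=
  𝓕 fun x => (u x : ℂ)

/-- The homogeneous Sobolev energy `∫ |ξ|^{2σ} |û(ξ)|² dξ`. -/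
noncomputable def fracEnergy {N : ℕ} (σ : ℝ) (u : EuclideanSpace ℝ (Fin N) → ℝ) : ℝ≥0∞ :=
  ∫⁻ ξ, ENNReal.ofReal (‖ξ‖ ^ (2 * σ)) * ‖fourierReal u ξ‖ₑ ^ 2

variable {N : ℕ} {Ω : Set (EuclideanSpace ℝ (Fin N))} {u v : EuclideanSpace ℝ (Fin N) → ℝ}

theorem IsTestFunction.fourierReal_eq (hu : IsTestFunction Ω u) :
    fourierReal u = (𝓕 hu.toSchwartz : SchwartzMap (EuclideanSpace ℝ (Fin N)) ℂ) := rfl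

theorem IsTestFunction.continuous_fourierReal (hu : IsTestFunction Ω u) :
    Continuous (fourierReal u) := by
  rw [hu.fourierReal_eq]
  exact SchwartzMap.continuous _

theorem IsTestFunction.plancherel (hu : IsTestFunction Ω u) :
    ∫⁻ ξ, ‖fourierReal u ξ‖ₑ ^ 2 = ∫⁻ x, ‖u x‖ₑ ^ 2 := by
  have := lintegral_enorm_sq_fourier hu.toSchwartz
  simpa [fourierReal, enorm_complex_ofReal] using this

theorem IsTestFunction.fracEnergy_zero (hu : IsTestFunction Ω u) :
    fracEnergy 0 u = ∫⁻ x, ‖u x‖ₑ ^ 2 := by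
  simp [fracEnergy, ← hu.plancherel]

theorem fourierReal_comp_add_right (u : EuclideanSpace ℝ (Fin N) → ℝ)
    (h ξ : EuclideanSpace ℝ (Fin N)) :
    fourierReal (fun x => u (x + h)) ξ =
      Complex.exp (Complex.I * (2 * Real.pi * inner ℝ h ξ : ℝ)) * fourierReal u ξ := by
  simp only [fourierReal, Real.fourier_eq']
  rw [← integral_add_right_eq_self (μ := volume) _ (-h), ← integral_const_mul]
  congr 1 with x
  simp only [neg_add_cancel_right, smul_eq_mul, ← mul_assoc, ← Complex.exp_add]
  congr 2
  rw [inner_add_left, inner_neg_left]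
  push_cast
  ring

theorem IsTestFunction.fourierReal_sub (hu : IsTestFunction Ω u) (hv : IsTestFunction Ω v)
    (ξ : EuclideanSpace ℝ (Fin N)) :
    fourierReal (fun x => u x - v x) ξ = fourierReal u ξ - fourierReal v ξ := by
  have h : (hu.sub hv).toSchwartz = hu.toSchwartz - hv.toSchwartz := by
    ext x; simp
  rw [(hu.sub hv).fourierReal_eq, hu.fourierReal_eq, hv.fourierReal_eq, h, sub_eq_add_neg,
    FourierTransform.fourier_add, FourierTransform.fourier_neg]
  rfl

theorem enorm_exp_sub_one_sq (θ : ℝ) :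
    ‖Complex.exp (Complex.I * θ) - 1‖ₑ ^ 2 = ENNReal.ofReal (2 - 2 * Real.cos θ) := by
  rw [← ofReal_norm, Complex.norm_exp_I_mul_ofReal_sub_one, ← ENNReal.ofReal_pow (norm_nonneg _),
    Real.norm_eq_abs, sq_abs]
  congr 1
  have h1 := Real.cos_two_mul (θ / 2)
  have h2 := Real.sin_sq_add_cos_sq (θ / 2)
  rw [mul_div_cancel₀ _ two_ne_zero] at h1
  linarith

/-- Plancherel for the difference of a translate and the function, whose Fourier transform is
$(e^{2\pi i\langle h,\xi\rangle}-1)\hat u(\xi)$. -/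
theorem IsTestFunction.lintegral_translate_sub_sq (hu : IsTestFunction univ u)
    (h : EuclideanSpace ℝ (Fin N)) :
    ∫⁻ y, ENNReal.ofReal ((u (y + h) - u y) ^ 2) =
      ∫⁻ ξ, ENNReal.ofReal (2 - 2 * Real.cos (2 * Real.pi * inner ℝ h ξ)) *
        ‖fourierReal u ξ‖ₑ ^ 2 := by
  have h1 := ((hu.comp_add_right h).sub hu).plancherel
  have h2 : ∀ y, ENNReal.ofReal ((u (y + h) - u y) ^ 2) = ‖u (y + h) - u y‖ₑ ^ 2 := by
    intro y
    rw [← ofReal_norm, ← ENNReal.ofReal_pow (norm_nonneg _), Real.norm_eq_abs, sq_abs]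
  simp_rw [h2, ← h1, (hu.comp_add_right h).fourierReal_sub hu, fourierReal_comp_add_right,
    ← enorm_exp_sub_one_sq, ← mul_pow, ← enorm_mul, sub_mul, one_mul]

/-- Substituting $x=y+h$ and applying Tonelli, the $y$ integral is evaluated by Plancherel for each
$h$; a second exchange of integrals leaves the symbol. -/
theorem IsTestFunction.gagliardoSq_eq_lintegral_symbol (hu : IsTestFunction univ u) (s : ℝ) :
    gagliardoSq s u = ∫⁻ ξ, fracSymbol s ξ * ‖fourierReal u ξ‖ₑ ^ 2 := by
  have hc := hu.continuous
  have hF := hu.continuous_fourierReal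
  have m1 : Measurable fun z : EuclideanSpace ℝ (Fin N) × EuclideanSpace ℝ (Fin N) =>
      ENNReal.ofReal ((u z.1 - u z.2) ^ 2 / ‖z.1 - z.2‖ ^ ((N : ℝ) + 2 * s)) := by
    have : Measurable u := hc.measurable
    fun_prop
  have m2 : Measurable fun z : EuclideanSpace ℝ (Fin N) × EuclideanSpace ℝ (Fin N) =>
      ENNReal.ofReal ((u (z.1 + z.2) - u z.1) ^ 2 / ‖z.2‖ ^ ((N : ℝ) + 2 * s)) := by
    have : Measurable u := hc.measurable
    fun_prop
  have m3 : Measurable fun z : EuclideanSpace ℝ (Fin N) × EuclideanSpace ℝ (Fin N) =>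
      ENNReal.ofReal ((2 - 2 * Real.cos (2 * Real.pi * inner ℝ z.1 z.2)) /
        ‖z.1‖ ^ ((N : ℝ) + 2 * s)) * ‖fourierReal u z.2‖ₑ ^ 2 := by
    have : Measurable (fourierReal u) := hF.measurable
    fun_prop
  calc
    gagliardoSq s u = ∫⁻ y, ∫⁻ x, ENNReal.ofReal ((u x - u y) ^ 2 /
        ‖x - y‖ ^ ((N : ℝ) + 2 * s)) := by
      rw [gagliardoSq, Measure.volume_eq_prod, lintegral_prod_symm _ m1.aemeasurable]
    _ = ∫⁻ y, ∫⁻ h, ENNReal.ofReal ((u (y + h) - u y) ^ 2 / ‖h‖ ^ ((N : ℝ) + 2 * s)) := by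
      congr 1 with y
      rw [← lintegral_add_left_eq_self (μ := volume) _ y]
      simp
    _ = ∫⁻ h, ∫⁻ y, ENNReal.ofReal ((u (y + h) - u y) ^ 2 / ‖h‖ ^ ((N : ℝ) + 2 * s)) :=
      lintegral_lintegral_swap m2.aemeasurable
    _ = ∫⁻ h, ∫⁻ ξ, ENNReal.ofReal ((2 - 2 * Real.cos (2 * Real.pi * inner ℝ h ξ)) /
        ‖h‖ ^ ((N : ℝ) + 2 * s)) * ‖fourierReal u ξ‖ₑ ^ 2 := by
      congr 1 with h
      simp_rw [div_eq_inv_mul, ENNReal.ofReal_mul (inv_nonneg.2 (Real.rpow_nonneg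
        (norm_nonneg h) _)), mul_assoc]
      rw [lintegral_const_mul' _ _ ENNReal.ofReal_ne_top,
        lintegral_const_mul' _ _ ENNReal.ofReal_ne_top, hu.lintegral_translate_sub_sq h]
      simp_rw [mul_assoc]
    _ = ∫⁻ ξ, ∫⁻ h, ENNReal.ofReal ((2 - 2 * Real.cos (2 * Real.pi * inner ℝ h ξ)) /
        ‖h‖ ^ ((N : ℝ) + 2 * s)) * ‖fourierReal u ξ‖ₑ ^ 2 :=
      lintegral_lintegral_swap m3.aemeasurable
    _ = _ := by
      congr 1 with ξ
      rw [lintegral_mul_const' _ _ (by simp)]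
      simp [fracSymbol]

theorem IsTestFunction.gagliardoSq_eq (hu : IsTestFunction univ u) {s : ℝ} (hs : 0 < s)
    {e : EuclideanSpace ℝ (Fin N)} (he : ‖e‖ = 1) :
    gagliardoSq s u = fracSymbol s e * fracEnergy s u := by
  rw [hu.gagliardoSq_eq_lintegral_symbol, fracEnergy, ← lintegral_const_mul]
  · congr 1 with ξ
    rw [fracSymbol_eq hs he ξ]
    ring
  · have : Measurable (fourierReal u) := hu.continuous_fourierReal.measurable
    fun_prop

theorem IsTestFunction.fourierReal_fderiv_apply (hu : IsTestFunction univ u)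
    (v ξ : EuclideanSpace ℝ (Fin N)) :
    fourierReal (fun x => fderiv ℝ u x v) ξ =
      2 * Real.pi * Complex.I * inner ℝ ξ v * fourierReal u ξ := by
  have h : (hu.fderiv_apply v).toSchwartz = LineDeriv.lineDerivOp v hu.toSchwartz := by
    ext x
    rw [SchwartzMap.lineDerivOp_apply_eq_fderiv]
    have : HasFDerivAt (fun x => (u x : ℂ)) (Complex.ofRealCLM ∘L fderiv ℝ u x) x :=
      Complex.ofRealCLM.hasFDerivAt.comp x
        (hu.smooth.differentiable (by simp) x).hasFDerivAt
    rw [hu.coe_toSchwartz, this.fderiv]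
    rfl
  have ht : (inner ℝ · v).HasTemperateGrowth := ((innerSL ℝ).flip v).hasTemperateGrowth
  rw [(hu.fderiv_apply v).fourierReal_eq, hu.fourierReal_eq, h, SchwartzMap.fourier_lineDerivOp_eq]
  simp [ht, mul_assoc]

theorem enorm_sq_eq_sum_inner (b : OrthonormalBasis (Fin N) ℝ (EuclideanSpace ℝ (Fin N)))
    (x : EuclideanSpace ℝ (Fin N)) : ‖x‖ₑ ^ 2 = ∑ i, ‖(inner ℝ x (b i) : ℝ)‖ₑ ^ 2 := by
  have h := b.sum_sq_norm_inner_left x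
  simp_rw [← ofReal_norm, ← ENNReal.ofReal_pow (norm_nonneg _)]
  rw [← ENNReal.ofReal_sum_of_nonneg fun i _ => by positivity, h]

theorem IsTestFunction.lintegral_gradient_sq (hu : IsTestFunction univ u) :
    ∫⁻ x, ‖gradient u x‖ₑ ^ 2 = ENNReal.ofReal (4 * Real.pi ^ 2) * fracEnergy 1 u := by
  set b := EuclideanSpace.basisFun (Fin N) ℝ
  have hF : Measurable (fourierReal u) := hu.continuous_fourierReal.measurable
  have hd : ∀ i, Measurable fun x => fderiv ℝ u x (b i) := fun i =>
    (hu.fderiv_apply (b i)).continuous.measurable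
  simp_rw [enorm_sq_eq_sum_inner b, inner_gradient_left]
  rw [lintegral_finsetSum _ fun i _ => by have := hd i; fun_prop]
  simp_rw [← (hu.fderiv_apply _).plancherel, hu.fourierReal_fderiv_apply]
  rw [← lintegral_finsetSum _ fun i _ => by fun_prop, fracEnergy,
    ← lintegral_const_mul _ (by fun_prop)]
  congr 1 with ξ
  simp_rw [enorm_mul, mul_pow]
  rw [← Finset.sum_mul, ← mul_assoc]
  congr 1
  rw [← Finset.mul_sum]
  simp_rw [enorm_complex_ofReal, ← enorm_sq_eq_sum_inner b ξ]
  rw [← ofReal_norm ξ, ← ENNReal.ofReal_pow (norm_nonneg _)]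
  congr 1
  · rw [Real.enorm_eq_ofReal Real.pi_pos.le, ENNReal.ofReal_mul (by norm_num),
      ← ENNReal.ofReal_pow Real.pi_pos.le]
    simp [← ofReal_norm]
    norm_num
  · norm_num

end Fourier

/-! ### A subcritical fractional Sobolev inequality -/

section Sobolev

/-- Layer cake formula, split at height $M$: below it the level sets have at most the total measure,
above it the weak bound is integrable because $q<p$. -/
theorem lintegral_rpow_le_of_weak_bound {α : Type*} [MeasurableSpace α] {μ : Measure α}
    {f : α → ℝ} (hf : AEMeasurable f μ) (hf0 : 0 ≤ f) {p q C M : ℝ} (hq : 0 < q) (hqp : q < p)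
    (hC : 0 ≤ C) (hM : 0 < M)
    (hw : ∀ t, 0 < t → μ {x | t < f x} ≤ ENNReal.ofReal (C * (M / t) ^ p)) :
    ∫⁻ x, ENNReal.ofReal (f x ^ q) ∂μ ≤
      (μ univ + ENNReal.ofReal (q * C / (p - q))) * ENNReal.ofReal (M ^ q) := by
  rw [lintegral_rpow_eq_lintegral_meas_lt_mul μ (ae_of_all _ hf0) hf hq,
    ← Ioc_union_Ioi_eq_Ioi hM.le]
  refine (mul_le_mul_right (lintegral_union_le _ _ _) _).trans ?_
  have h1 : ∫⁻ t in Ioc 0 M, μ {a | t < f a} * ENNReal.ofReal (t ^ (q - 1)) ≤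
      μ univ * ENNReal.ofReal (M ^ q / q) := by
    calc _ ≤ ∫⁻ t in Ioc 0 M, μ univ * ENNReal.ofReal (t ^ (q - 1)) :=
          lintegral_mono fun t => mul_le_mul_left (measure_mono (subset_univ _)) _
      _ = _ := by
        rw [lintegral_const_mul _ (by fun_prop), ← ofReal_integral_eq_lintegral_ofReal]
        · rw [← intervalIntegral.integral_of_le hM.le, integral_rpow (Or.inl (by linarith)),
            Real.zero_rpow (by linarith)]
          simp
        · exact (intervalIntegrable_iff_integrableOn_Ioc_of_le hM.le).1
            (intervalIntegral.intervalIntegrable_rpow' (by linarith))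
        · exact (ae_restrict_mem measurableSet_Ioc).mono fun y hy => Real.rpow_nonneg hy.1.le _
  have h2 : ∫⁻ t in Ioi M, μ {a | t < f a} * ENNReal.ofReal (t ^ (q - 1)) ≤
      ENNReal.ofReal (C * M ^ q / (p - q)) := by
    calc _ ≤ ∫⁻ t in Ioi M, ENNReal.ofReal (C * M ^ p) * ENNReal.ofReal (t ^ (q - 1 - p)) := by
          refine setLIntegral_mono' measurableSet_Ioi fun t ht => ?_
          have ht0 : 0 < t := hM.trans ht
          refine (mul_le_mul_left (hw t ht0) _).trans (le_of_eq ?_)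
          rw [← ENNReal.ofReal_mul (by positivity), ← ENNReal.ofReal_mul (by positivity),
            Real.div_rpow hM.le ht0.le, Real.rpow_sub ht0 (q - 1) p]
          congr 1
          ring
      _ = _ := by
        rw [lintegral_const_mul _ (by fun_prop), ← ofReal_integral_eq_lintegral_ofReal]
        · rw [integral_Ioi_rpow_of_lt (by linarith) hM, ← ENNReal.ofReal_mul (by positivity)]
          congr 1
          rw [show q - 1 - p + 1 = q - p by ring, Real.rpow_sub hM, ← neg_sub p q]
          have : M ^ p ≠ 0 := (Real.rpow_pos_of_pos hM p).ne'
          have : p - q ≠ 0 := by linarith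
          field_simp
        · exact integrableOn_Ioi_rpow_of_lt (by linarith) hM
        · exact (ae_restrict_mem measurableSet_Ioi).mono fun y hy =>
            Real.rpow_nonneg (hM.trans hy).le _
  refine (mul_le_mul_right (add_le_add h1 h2) _).trans (le_of_eq ?_)
  rw [mul_add, add_mul, mul_left_comm, ← ENNReal.ofReal_mul hq.le, mul_div_cancel₀ _ hq.ne',
    ← ENNReal.ofReal_mul hq.le,
    ← ENNReal.ofReal_mul (div_nonneg (by positivity) (sub_pos.2 hqp).le)]
  congr 2
  ring

variable {N : ℕ} {u : EuclideanSpace ℝ (Fin N) → ℝ}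

/-- Cauchy–Schwarz for the product $|\xi|^{-\sigma}\cdot|\xi|^{\sigma}|\hat u|$; the weight
$|\xi|^{-2\sigma}$ is integrable at the origin since $2\sigma<N$. -/
theorem lintegral_ball_fourierReal_le [NeZero N] (hu : IsTestFunction univ u) {σ R : ℝ}
    (hσ : 2 * σ < N) (hR : 0 < R) :
    ∫⁻ ξ in Metric.ball (0 : EuclideanSpace ℝ (Fin N)) R, ‖fourierReal u ξ‖ₑ ≤
      (ENNReal.ofReal (N * R ^ (N - 2 * σ) / (N - 2 * σ)) * unitBallVolume N) ^ (1 / 2 : ℝ) *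
        fracEnergy σ u ^ (1 / 2 : ℝ) := by
  have hF : Measurable (fourierReal u) := hu.continuous_fourierReal.measurable
  set f : EuclideanSpace ℝ (Fin N) → ℝ≥0∞ := fun ξ => ENNReal.ofReal (‖ξ‖ ^ (-σ)) with hf
  set g : EuclideanSpace ℝ (Fin N) → ℝ≥0∞ :=
    fun ξ => ENNReal.ofReal (‖ξ‖ ^ σ) * ‖fourierReal u ξ‖ₑ with hg
  have hfm : Measurable f := by fun_prop
  have hgm : Measurable g := by fun_prop
  have e1 : ∫⁻ ξ in Metric.ball (0 : EuclideanSpace ℝ (Fin N)) R, ‖fourierReal u ξ‖ₑ =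
      ∫⁻ ξ in Metric.ball (0 : EuclideanSpace ℝ (Fin N)) R, (f * g) ξ := by
    refine lintegral_congr_ae (ae_restrict_of_ae (ae_ne_zero.mono fun ξ hξ => ?_))
    have : 0 < ‖ξ‖ := norm_pos_iff.2 hξ
    rw [Pi.mul_apply, hf, hg, ← mul_assoc, ← ENNReal.ofReal_mul (by positivity), ← Real.rpow_add this]
    simp
  rw [e1]
  refine (ENNReal.lintegral_mul_le_Lp_mul_Lq _ Real.HolderConjugate.two_two hfm.aemeasurable
    hgm.aemeasurable).trans ?_
  gcongr
  · have hpos : 0 < (Module.finrank ℝ (EuclideanSpace ℝ (Fin N)) : ℝ) + -(2 * σ) := by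
      simpa using hσ
    have := lintegral_ball_norm_rpow hpos hR
    rw [finrank_euclideanSpace_fin, ← sub_eq_add_neg] at this
    rw [unitBallVolume, ← this]
    refine lintegral_mono fun ξ => ?_
    rw [ENNReal.ofReal_rpow_of_nonneg (by positivity) (by norm_num), ← Real.rpow_mul
      (norm_nonneg _)]
    exact le_of_eq (by ring_nf)
  · refine (setLIntegral_le_lintegral _ _).trans (lintegral_mono fun ξ => ?_)
    rw [ENNReal.mul_rpow_of_nonneg _ _ (by norm_num),
      ENNReal.ofReal_rpow_of_nonneg (by positivity) (by norm_num), ← Real.rpow_mul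
      (norm_nonneg _), ENNReal.rpow_two]
    exact le_of_eq (by ring_nf)

theorem enorm_fourierInv_le {V : Type*} [NormedAddCommGroup V] [InnerProductSpace ℝ V]
    [FiniteDimensional ℝ V] [MeasurableSpace V] [BorelSpace V] (g : V → ℂ) (x : V) :
    ‖𝓕⁻ g x‖ₑ ≤ ∫⁻ ξ, ‖g ξ‖ₑ := by
  rw [Real.fourierInv_eq]
  refine (enorm_integral_le_lintegral_enorm _).trans (lintegral_mono fun ξ => ?_)
  rw [← ofReal_norm, ← ofReal_norm, Circle.norm_smul]

/-- Splitting of a test function into low and high frequencies. -/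
theorem exists_frequency_splitting (hu : IsTestFunction univ u) {A : ℝ} (hA : 0 < A) {σ : ℝ}
    (hσ : 0 ≤ σ) : ∃ low high : SchwartzMap (EuclideanSpace ℝ (Fin N)) ℂ,
      (∀ x, (u x : ℂ) = low x + high x) ∧
      (∀ x, ‖low x‖ₑ ≤ ∫⁻ ξ in Metric.ball (0 : EuclideanSpace ℝ (Fin N)) (2 * A),
        ‖fourierReal u ξ‖ₑ) ∧
      ∫⁻ x, ‖high x‖ₑ ^ 2 ≤ ENNReal.ofReal (A ^ (-2 * σ)) * fracEnergy σ u := by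
  -- The low part is the inverse transform of $\chi\hat u$. The multiplier $1-\chi$ of the high part
  -- vanishes for $|\xi|\le A$, whence $(1-\chi)^2\le A^{-2\sigma}|\xi|^{2\sigma}$.
  let χ : ContDiffBump (0 : EuclideanSpace ℝ (Fin N)) :=
    { rIn := A, rOut := 2 * A, rIn_pos := hA, rIn_lt_rOut := by linarith }
  have hF : Measurable (fourierReal u) := hu.continuous_fourierReal.measurable
  have hχ1 : ∀ ξ, χ ξ ≤ 1 := fun ξ => χ.le_one
  have hχ0 : ∀ ξ, 0 ≤ χ ξ := fun ξ => χ.nonneg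
  have hsm : ContDiff ℝ ∞ fun ξ => (χ ξ : ℂ) * fourierReal u ξ := by
    refine (Complex.ofRealCLM.contDiff.comp χ.contDiff).mul ?_
    rw [hu.fourierReal_eq]
    exact SchwartzMap.smooth _ _
  have hcs : HasCompactSupport fun ξ => (χ ξ : ℂ) * fourierReal u ξ :=
    (χ.hasCompactSupport.comp_left (g := fun r : ℝ => (r : ℂ)) rfl).mul_right
  set g := hcs.toSchwartzMap hsm with hg
  have hgξ : ∀ ξ, g ξ = (χ ξ : ℂ) * fourierReal u ξ := fun ξ => rfl
  refine ⟨𝓕⁻ g, hu.toSchwartz - 𝓕⁻ g, fun x => by simp, fun x => ?_, ?_⟩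
  · rw [SchwartzMap.fourierInv_coe]
    refine (enorm_fourierInv_le _ x).trans ?_
    rw [← lintegral_indicator Metric.isOpen_ball.measurableSet]
    refine lintegral_mono fun ξ => ?_
    rw [hgξ, enorm_mul, enorm_complex_ofReal, Real.enorm_eq_ofReal (hχ0 ξ)]
    by_cases h : ξ ∈ Metric.ball (0 : EuclideanSpace ℝ (Fin N)) (2 * A)
    · rw [indicator_of_mem h]
      exact mul_le_of_le_one_left' (by simpa using hχ1 ξ)
    · have : χ ξ = 0 := by
        rw [← Function.notMem_support, χ.support_eq]
        exact h
      simp [this]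
  · rw [← lintegral_enorm_sq_fourier, fracEnergy, ← lintegral_const_mul _ (by fun_prop)]
    refine lintegral_mono fun ξ => ?_
    have e : 𝓕 ((hu.toSchwartz - 𝓕⁻ g : SchwartzMap (EuclideanSpace ℝ (Fin N)) ℂ) :
        EuclideanSpace ℝ (Fin N) → ℂ) ξ = (1 - χ ξ : ℝ) * fourierReal u ξ := by
      rw [← SchwartzMap.fourier_coe, sub_eq_add_neg, FourierTransform.fourier_add,
        FourierTransform.fourier_neg, FourierTransform.fourier_fourierInv_eq, add_apply,
        neg_apply, hgξ, hu.fourierReal_eq]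
      push_cast
      ring
    rw [e, enorm_mul, enorm_complex_ofReal, Real.enorm_eq_ofReal (sub_nonneg.2 (hχ1 ξ)), mul_pow,
      ← mul_assoc]
    gcongr
    rw [← ENNReal.ofReal_mul (by positivity), ← ENNReal.ofReal_pow (sub_nonneg.2 (hχ1 ξ))]
    apply ENNReal.ofReal_le_ofReal
    by_cases h : ‖ξ‖ ≤ A
    · have : χ ξ = 1 := χ.one_of_mem_closedBall (by simpa using h)
      rw [this, sub_self, zero_pow two_ne_zero]
      positivity
    · push Not at h
      calc (1 - χ ξ) ^ 2 ≤ 1 ^ 2 := by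
            have := hχ0 ξ
            have := hχ1 ξ
            gcongr; linarith
        _ = A ^ (-2 * σ) * A ^ (2 * σ) := by
            rw [← Real.rpow_add hA]
            simp
        _ ≤ _ := by gcongr

/-- The weak form of the fractional Sobolev inequality, at the critical exponent. At each height $t$
the frequency cutoff is chosen so that the low part is at most $t/2$ in sup norm; then $|u|>t$
forces the high part above $t/2$, and Chebyshev applies. -/
theorem measure_lt_abs_le [NeZero N] {σ : ℝ} (hσ0 : 0 < σ) (hσ : 2 * σ < N) :
    ∃ C : ℝ, 0 ≤ C ∧ ∀ u : EuclideanSpace ℝ (Fin N) → ℝ, IsTestFunction univ u → ∀ M : ℝ, 0 < M →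
      fracEnergy σ u ≤ ENNReal.ofReal (M ^ 2) → ∀ t : ℝ, 0 < t →
      volume {x | t < |u x|} ≤ ENNReal.ofReal (C * (M / t) ^ (2 * N / (N - 2 * σ))) := by
  have hβ : 0 < (N : ℝ) - 2 * σ := by linarith
  have hN : 0 < (N : ℝ) := by linarith
  set W : ℝ := (unitBallVolume N).toReal with hW
  have hWt : unitBallVolume N = ENNReal.ofReal W :=
    (ENNReal.ofReal_toReal measure_ball_lt_top.ne).symm
  have hW0 : 0 < W := ENNReal.toReal_pos (Metric.measure_ball_pos _ _ one_pos).ne'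
    measure_ball_lt_top.ne
  set c : ℝ := (N * 2 ^ (N - 2 * σ) / (N - 2 * σ) * W) ^ (1 / 2 : ℝ) with hc
  have hc0 : 0 < c := by positivity
  refine ⟨4 * (2 * c) ^ (4 * σ / (N - 2 * σ)), by positivity, fun u hu M hM hE t ht => ?_⟩
  -- This $A$ solves $cA^{(N-2\sigma)/2}M=t/2$, the left side being the sup bound for frequencies in
  -- the ball of radius $2A$; the factor $2^{N-2\sigma}$ in $c$ comes from that radius.
  set A : ℝ := (t / (2 * c * M)) ^ (2 / (N - 2 * σ)) with hAdef
  have hA : 0 < A := by positivity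
  obtain ⟨low, high, hsplit, hlow, hhigh⟩ := exists_frequency_splitting hu hA hσ0.le
  have hlow' : ∀ x, ‖low x‖ ≤ t / 2 := by
    intro x
    have h1 := (hlow x).trans (lintegral_ball_fourierReal_le hu hσ (by positivity))
    have h2 : fracEnergy σ u ^ (1 / 2 : ℝ) ≤ ENNReal.ofReal M := by
      calc _ ≤ ENNReal.ofReal (M ^ 2) ^ (1 / 2 : ℝ) := by gcongr
        _ = _ := by
          rw [ENNReal.ofReal_rpow_of_nonneg (by positivity) (by norm_num), ← Real.sqrt_eq_rpow,
            Real.sqrt_sq hM.le]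
    have h3 : ‖low x‖ₑ ≤ ENNReal.ofReal (t / 2) := by
      refine h1.trans ((mul_le_mul_right h2 _).trans (le_of_eq ?_))
      rw [hWt, ← ENNReal.ofReal_mul (by positivity),
        ENNReal.ofReal_rpow_of_nonneg (by positivity) (by norm_num),
        ← ENNReal.ofReal_mul (by positivity)]
      congr 1
      rw [Real.mul_rpow (x := 2) (by norm_num) hA.le, hAdef, ← Real.rpow_mul (by positivity),
        div_mul_cancel₀ _ hβ.ne', Real.rpow_two]
      have : ((N : ℝ) * (2 ^ ((N : ℝ) - 2 * σ) * (t / (2 * c * M)) ^ 2) / (N - 2 * σ) * W) =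
          (N * 2 ^ (N - 2 * σ) / (N - 2 * σ) * W) * (t / (2 * c * M)) ^ 2 := by ring
      rw [this, Real.mul_rpow (by positivity) (by positivity), ← hc, ← Real.sqrt_eq_rpow,
        Real.sqrt_sq (by positivity)]
      field_simp
    rwa [← ofReal_norm, ENNReal.ofReal_le_ofReal_iff (by positivity)] at h3
  have hsub : {x | t < |u x|} ⊆ {x | ENNReal.ofReal ((t / 2) ^ 2) ≤ ‖high x‖ₑ ^ 2} := by
    intro x hx
    simp only [mem_ofPred_eq] at hx ⊢
    rw [← ofReal_norm, ← ENNReal.ofReal_pow (norm_nonneg _)]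
    apply ENNReal.ofReal_le_ofReal
    have h1 : |u x| ≤ ‖low x‖ + ‖high x‖ := by
      rw [← Real.norm_eq_abs, ← Complex.norm_real, hsplit x]
      exact norm_add_le _ _
    have := hlow' x
    gcongr
    linarith
  have hmeas : Measurable fun x => ‖high x‖ₑ ^ 2 := by
    have := high.continuous.measurable
    fun_prop
  have hcheb := mul_meas_ge_le_lintegral (μ := volume) hmeas (ENNReal.ofReal ((t / 2) ^ 2))
  have hpos : 0 < (t / 2) ^ 2 := by positivity
  calc volume {x | t < |u x|}
      ≤ volume {x | ENNReal.ofReal ((t / 2) ^ 2) ≤ ‖high x‖ₑ ^ 2} := measure_mono hsub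
    _ ≤ (∫⁻ x, ‖high x‖ₑ ^ 2) / ENNReal.ofReal ((t / 2) ^ 2) := by
      rw [ENNReal.le_div_iff_mul_le (Or.inl (ENNReal.ofReal_pos.2 hpos).ne')
        (Or.inl ENNReal.ofReal_ne_top),
        mul_comm]
      exact hcheb
    _ ≤ ENNReal.ofReal (A ^ (-2 * σ)) * ENNReal.ofReal (M ^ 2) / ENNReal.ofReal ((t / 2) ^ 2) := by
      gcongr
      exact hhigh.trans (by gcongr)
    _ = _ := by
      rw [← ENNReal.ofReal_mul (by positivity), ← ENNReal.ofReal_div_of_pos hpos]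
      congr 1
      have e1 : A ^ (-2 * σ) = (2 * c) ^ (4 * σ / (N - 2 * σ)) * (M / t) ^ (4 * σ / (N - 2 * σ)) := by
        rw [hAdef, ← Real.rpow_mul (by positivity), ← Real.mul_rpow (by positivity)
          (by positivity), show 2 * c * (M / t) = (t / (2 * c * M))⁻¹ by field_simp,
          Real.inv_rpow (by positivity), ← Real.rpow_neg (by positivity)]
        congr 1
        ring
      have e2 : (M / t) ^ (2 * N / (N - 2 * σ)) = (M / t) ^ (4 * σ / (N - 2 * σ)) * (M / t) ^ 2 := by
        rw [← Real.rpow_two, ← Real.rpow_add (by positivity)]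
        congr 1
        field_simp
        ring
      rw [e1, e2]
      field_simp
      norm_num

/-- On a set of finite measure the weak bound at the exponent $2N/(N-2\sigma)$ yields the strong
bound for every smaller $q$. The positive number $M$, rather than the energy itself, also covers the
case of zero energy. -/
theorem exists_eLpNorm_le_fracEnergy [NeZero N] {σ q : ℝ} (hσ0 : 0 < σ) (hσ : 2 * σ < N)
    (hq : 0 < q) (hqσ : q * (N - 2 * σ) < 2 * N) {B : Set (EuclideanSpace ℝ (Fin N))}
    (hB : volume B ≠ ⊤) :
    ∃ C : ℝ, 0 ≤ C ∧ ∀ u : EuclideanSpace ℝ (Fin N) → ℝ, IsTestFunction univ u → ∀ M : ℝ, 0 < M →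
      fracEnergy σ u ≤ ENNReal.ofReal (M ^ 2) →
      eLpNorm u (ENNReal.ofReal q) (volume.restrict B) ≤ ENNReal.ofReal (C * M) := by
  obtain ⟨C, hC0, hC⟩ := measure_lt_abs_le (N := N) hσ0 hσ
  have hβ : 0 < (N : ℝ) - 2 * σ := by linarith
  have hqp : q < 2 * N / (N - 2 * σ) := by rwa [lt_div_iff₀ hβ]
  set D : ℝ := (volume B).toReal + q * C / (2 * N / (N - 2 * σ) - q)
  have hD : 0 ≤ D := add_nonneg ENNReal.toReal_nonneg
    (div_nonneg (by positivity) (sub_pos.2 hqp).le)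
  refine ⟨D ^ (1 / q), by positivity, fun u hu M hM hE => ?_⟩
  have h1 := lintegral_rpow_le_of_weak_bound (μ := volume.restrict B) (f := fun x => |u x|)
    (hu.continuous.abs.measurable.aemeasurable) (fun x => abs_nonneg _) hq hqp hC0 hM
    (fun t ht => (Measure.restrict_apply_le _ _).trans (hC u hu M hM hE t ht))
  have h2 : ∫⁻ x in B, ENNReal.ofReal (|u x| ^ q) ≤ ENNReal.ofReal (D * M ^ q) := by
    refine h1.trans (le_of_eq ?_)
    rw [Measure.restrict_apply_univ, ← ENNReal.ofReal_toReal hB, ← ENNReal.ofReal_add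
      ENNReal.toReal_nonneg (div_nonneg (by positivity) (sub_pos.2 hqp).le),
      ← ENNReal.ofReal_mul hD]
  rw [eLpNorm_eq_lintegral_rpow_enorm_toReal (by simpa using hq) ENNReal.ofReal_ne_top,
    ENNReal.toReal_ofReal hq.le]
  have h3 : ∀ x, ‖u x‖ₑ ^ q = ENNReal.ofReal (|u x| ^ q) := fun x => by
    rw [← ofReal_norm, ENNReal.ofReal_rpow_of_nonneg (norm_nonneg _) hq.le, Real.norm_eq_abs]
  simp_rw [h3]
  calc _ ≤ ENNReal.ofReal (D * M ^ q) ^ (1 / q) := by gcongr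
    _ = _ := by
      rw [ENNReal.ofReal_rpow_of_nonneg (by positivity) (by positivity),
        Real.mul_rpow hD (by positivity), ← Real.rpow_mul hM.le, mul_one_div_cancel hq.ne',
        Real.rpow_one]

end Sobolev

open scoped FourierTransform Convolution

/-! ### Mollified translations as Fourier multipliers -/

section Mollification

variable {N : ℕ} {u ρ : EuclideanSpace ℝ (Fin N) → ℝ}

theorem IsTestFunction.integrable_ofReal {Ω : Set (EuclideanSpace ℝ (Fin N))}
    (hu : IsTestFunction Ω u) : Integrable fun x => (u x : ℂ) :=
  hu.toSchwartz.integrable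

/-- A mollifier supported in the ball of radius `δ`. -/
structure IsMollifier (δ : ℝ) (ρ : EuclideanSpace ℝ (Fin N) → ℝ) : Prop where
  isTest : IsTestFunction univ ρ
  nonneg : ∀ x, 0 ≤ ρ x
  support : ∀ x, ρ x ≠ 0 → ‖x‖ ≤ δ
  integral_eq : ∫ x, ρ x = 1

theorem exists_isMollifier {δ : ℝ} (hδ : 0 < δ) :
    ∃ ρ : EuclideanSpace ℝ (Fin N) → ℝ, IsMollifier δ ρ := by
  let χ : ContDiffBump (0 : EuclideanSpace ℝ (Fin N)) :=
    { rIn := δ / 2, rOut := δ, rIn_pos := by linarith, rIn_lt_rOut := by linarith }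
  refine ⟨χ.normed volume, isTestFunction_univ_iff.2 ⟨χ.contDiff_normed,
    χ.hasCompactSupport_normed⟩, fun x => χ.nonneg_normed x, fun x hx => ?_, χ.integral_normed⟩
  have : x ∈ Function.support (χ.normed volume) := hx
  rw [χ.support_normed_eq] at this
  exact (mem_ball_zero_iff.1 this).le

/-- The convolution of two real functions. -/
noncomputable def mollify (ρ u : EuclideanSpace ℝ (Fin N) → ℝ) : EuclideanSpace ℝ (Fin N) → ℝ :=
  ρ ⋆[ContinuousLinearMap.lsmul ℝ ℝ] u

theorem IsTestFunction.mollify (hρ : IsTestFunction univ ρ) (hu : IsTestFunction univ u) :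
    IsTestFunction univ (mollify ρ u) :=
  isTestFunction_univ_iff.2 ⟨hu.compact.contDiff_convolution_right _
    hρ.integrable.locallyIntegrable hu.smooth, hρ.compact.convolution _ hu.compact⟩

theorem exists_of_mollify_ne_zero {δ : ℝ} (hρ : IsMollifier δ ρ)
    {x : EuclideanSpace ℝ (Fin N)} (hx : mollify ρ u x ≠ 0) : ∃ y, u y ≠ 0 ∧ ‖x - y‖ ≤ δ := by
  by_contra! h
  refine hx ?_
  rw [_root_.mollify, convolution_def]
  refine integral_eq_zero_of_ae (ae_of_all _ fun t => ?_)
  by_cases ht : ρ t = 0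
  · simp [ht]
  · by_cases hu : u (x - t) = 0
    · simp [hu]
    · exact absurd (hρ.support t ht) (not_le.2 (by simpa using h _ hu))

theorem fourierReal_mollify (hρ : IsTestFunction univ ρ) (hu : IsTestFunction univ u)
    (ξ : EuclideanSpace ℝ (Fin N)) :
    fourierReal (mollify ρ u) ξ = fourierReal ρ ξ * fourierReal u ξ := by
  have h : (fun x => (mollify ρ u x : ℂ)) =
      ((fun x => (ρ x : ℂ)) ⋆[ContinuousLinearMap.mul ℂ ℂ] fun x => (u x : ℂ)) := by
    ext x
    rw [_root_.mollify, convolution_def, convolution_def, ← integral_complex_ofReal]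
    simp
  rw [fourierReal, h, Real.fourier_mul_convolution_eq hρ.integrable_ofReal hu.integrable_ofReal]
  rfl

theorem IsMollifier.norm_fourierReal_le {δ : ℝ} (hρ : IsMollifier δ ρ)
    (ξ : EuclideanSpace ℝ (Fin N)) : ‖fourierReal ρ ξ‖ ≤ 1 := by
  rw [fourierReal, Real.fourier_eq]
  refine (norm_integral_le_integral_norm _).trans (le_of_eq ?_)
  rw [← hρ.integral_eq]
  congr 1 with x
  rw [Circle.norm_smul, Complex.norm_real, Real.norm_of_nonneg (hρ.nonneg x)]

/-- As $\rho$ has mass one, the left side is the modulus of the $\rho$-average of $e^{2\pi i\langle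
k-y,\xi\rangle}-1$, and $|e^{i\theta}-1|\le|\theta|$ with $|y|\le\delta$ on the support. -/
theorem IsMollifier.norm_exp_mul_fourierReal_sub_one_le {δ : ℝ} (hρ : IsMollifier δ ρ)
    (k ξ : EuclideanSpace ℝ (Fin N)) :
    ‖Complex.exp (Complex.I * (2 * Real.pi * inner ℝ k ξ : ℝ)) * fourierReal ρ ξ - 1‖ ≤
      2 * Real.pi * (‖k‖ + δ) * ‖ξ‖ := by
  have hi := hρ.isTest.integrable
  have hi' := hρ.isTest.integrable_ofReal
  have h0 : Complex.exp (Complex.I * (2 * Real.pi * inner ℝ k ξ : ℝ)) * fourierReal ρ ξ - 1 =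
      ∫ y, (Complex.exp (Complex.I * (2 * Real.pi * inner ℝ (k - y) ξ : ℝ)) - 1) * ρ y := by
    have h1 : (1 : ℂ) = ∫ y, (ρ y : ℂ) := by
      rw [integral_complex_ofReal, hρ.integral_eq]; simp
    have h2 : Integrable fun y =>
        Complex.exp (Complex.I * (2 * Real.pi * inner ℝ (k - y) ξ : ℝ)) * (ρ y : ℂ) := by
      refine hi'.bdd_mul (c := 1) (by fun_prop) (ae_of_all _ fun y => ?_)
      rw [Complex.norm_exp_I_mul_ofReal]
    simp_rw [sub_mul, one_mul]
    rw [integral_sub h2 hi', fourierReal, Real.fourier_eq', ← integral_const_mul]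
    congr 1
    · congr 1 with y
      rw [smul_eq_mul, ← mul_assoc, ← Complex.exp_add]
      congr 2
      rw [inner_sub_left]
      push_cast
      ring
  rw [h0]
  calc _ ≤ ∫ y, ‖(Complex.exp (Complex.I * (2 * Real.pi * inner ℝ (k - y) ξ : ℝ)) - 1) * ρ y‖ :=
        norm_integral_le_integral_norm _
    _ ≤ ∫ y, 2 * Real.pi * (‖k‖ + δ) * ‖ξ‖ * ρ y := by
      refine integral_mono_of_nonneg (ae_of_all _ fun y => norm_nonneg _) (hi.const_mul _)
        (ae_of_all _ fun y => ?_)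
      simp only
      rw [norm_mul, Complex.norm_real, Real.norm_of_nonneg (hρ.nonneg y)]
      by_cases hy : ρ y = 0
      · simp [hy]
      refine mul_le_mul_of_nonneg_right ?_ (hρ.nonneg y)
      refine Real.norm_exp_I_mul_ofReal_sub_one_le.trans ?_
      rw [norm_mul, Real.norm_of_nonneg (by positivity), mul_assoc (2 * Real.pi)]
      gcongr
      refine (norm_inner_le_norm _ _).trans ?_
      gcongr
      exact (norm_sub_le _ _).trans (by linarith [hρ.support y hy])
    _ = _ := by rw [integral_const_mul, hρ.integral_eq, mul_one]

/-- The difference is the multiplier $m$ applied to $u$, with $|m|\le2$ and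
$|m|\le2\pi(\|k\|+\delta)|\xi|$. Interpolating the two bounds trades the $s-\sigma$ spare
derivatives for a power of the displacement. -/
theorem fracEnergy_mollify_translate_sub_le [NeZero N] {δ : ℝ} (hρ : IsMollifier δ ρ)
    (hu : IsTestFunction univ u) (k : EuclideanSpace ℝ (Fin N)) {σ s : ℝ} (hσs : σ ≤ s)
    (hs : s ≤ σ + 1) (hδ : 0 ≤ δ) :
    fracEnergy σ (fun x => mollify ρ u (x + k) - u x) ≤
      ENNReal.ofReal (4 * (Real.pi * (‖k‖ + δ)) ^ (2 * (s - σ))) * fracEnergy s u := by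
  have hw := hρ.isTest.mollify hu
  have hF : Measurable (fourierReal u) := hu.continuous_fourierReal.measurable
  rw [fracEnergy, fracEnergy, ← lintegral_const_mul _ (by fun_prop)]
  refine lintegral_mono_ae (ae_ne_zero.mono fun ξ hξ => ?_)
  have hξ0 : 0 < ‖ξ‖ := norm_pos_iff.2 hξ
  rw [(hw.comp_add_right k).fourierReal_sub hu, fourierReal_comp_add_right,
    fourierReal_mollify hρ.isTest hu, ← mul_assoc, ← sub_one_mul, enorm_mul, mul_pow, ← mul_assoc,
    ← mul_assoc]
  refine mul_le_mul' ?_ le_rfl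
  set m := Complex.exp (Complex.I * (2 * Real.pi * inner ℝ k ξ : ℝ)) * fourierReal ρ ξ - 1
  have hm1 : ‖m‖ / 2 ≤ 1 := by
    have : ‖m‖ ≤ 1 + 1 := by
      refine (norm_sub_le _ _).trans ?_
      rw [norm_mul, Complex.norm_exp_I_mul_ofReal, one_mul, norm_one]
      gcongr
      exact hρ.norm_fourierReal_le ξ
    linarith
  have hm2 : ‖m‖ / 2 ≤ Real.pi * (‖k‖ + δ) * ‖ξ‖ := by
    have := hρ.norm_exp_mul_fourierReal_sub_one_le k ξ
    linarith
  have hm3 : ‖m‖ ^ 2 ≤ 4 * (Real.pi * (‖k‖ + δ) * ‖ξ‖) ^ (2 * (s - σ)) := by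
    calc ‖m‖ ^ 2 = 4 * (‖m‖ / 2) ^ (2 : ℝ) := by rw [Real.rpow_two]; ring
      _ ≤ 4 * (‖m‖ / 2) ^ (2 * (s - σ)) := by
        gcongr 4 * ?_
        -- The exponent is lowered from $2$ to $2(s-\sigma)$, using $|m|/2\le1$. The zero base is
        -- treated separately, since the new exponent may be $0$.
        rcases (norm_nonneg m).eq_or_lt with h | h
        · rw [← h, zero_div, Real.zero_rpow two_ne_zero]
          positivity
        · exact Real.rpow_le_rpow_of_exponent_ge (by positivity) hm1 (by linarith)
      _ ≤ _ := by gcongr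
  rw [← ofReal_norm, ← ENNReal.ofReal_pow (norm_nonneg _), ← ENNReal.ofReal_mul (by positivity),
    ← ENNReal.ofReal_mul (by positivity)]
  apply ENNReal.ofReal_le_ofReal
  calc ‖ξ‖ ^ (2 * σ) * ‖m‖ ^ 2
      ≤ ‖ξ‖ ^ (2 * σ) * (4 * (Real.pi * (‖k‖ + δ) * ‖ξ‖) ^ (2 * (s - σ))) := by gcongr
    _ = 4 * (Real.pi * (‖k‖ + δ)) ^ (2 * (s - σ)) * (‖ξ‖ ^ (2 * σ) * ‖ξ‖ ^ (2 * (s - σ))) := by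
      rw [Real.mul_rpow (by positivity) hξ0.le]; ring
    _ = _ := by
      rw [← Real.rpow_add hξ0]; ring_nf

/-- Since $|\hat\rho|\le1$ and $|\xi||\hat\rho|\le C$, one has
$|\xi|^2|\hat\rho|^2\le(|\xi||\hat\rho|)^{2(1-s)}|\xi|^{2s}$. For a fixed mollifier the constant
tends to $1$ as $s\nearrow1$, so the sharp factor in the limit is not lost. -/
theorem exists_fracEnergy_one_mollify_le [NeZero N] {δ : ℝ} (hρ : IsMollifier δ ρ) :
    ∃ C : ℝ, 0 < C ∧ ∀ u : EuclideanSpace ℝ (Fin N) → ℝ, IsTestFunction univ u →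
      ∀ s : ℝ, 0 ≤ s → s ≤ 1 →
        fracEnergy 1 (mollify ρ u) ≤ ENNReal.ofReal (C ^ (2 * (1 - s))) * fracEnergy s u := by
  obtain ⟨C, hC0, hC⟩ := (𝓕 hρ.isTest.toSchwartz : SchwartzMap _ ℂ).decay 1 0
  refine ⟨C, hC0, fun u hu s hs0 hs1 => ?_⟩
  have hF : Measurable (fourierReal u) := hu.continuous_fourierReal.measurable
  rw [fracEnergy, fracEnergy, ← lintegral_const_mul _ (by fun_prop)]
  refine lintegral_mono_ae (ae_ne_zero.mono fun ξ hξ => ?_)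
  have hξ0 : 0 < ‖ξ‖ := norm_pos_iff.2 hξ
  have hC' : ‖ξ‖ * ‖fourierReal ρ ξ‖ ≤ C := by
    simpa [hρ.isTest.fourierReal_eq] using hC ξ
  rw [fourierReal_mollify hρ.isTest hu, enorm_mul, mul_pow, ← mul_assoc, ← mul_assoc]
  refine mul_le_mul' ?_ le_rfl
  rw [← ofReal_norm, ← ENNReal.ofReal_pow (norm_nonneg _), ← ENNReal.ofReal_mul (by positivity),
    ← ENNReal.ofReal_mul (by positivity)]
  apply ENNReal.ofReal_le_ofReal
  set m := ‖fourierReal ρ ξ‖ with hm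
  have hm0 : 0 ≤ m := norm_nonneg _
  have hm1 : m ≤ 1 := hρ.norm_fourierReal_le ξ
  have h2 : m ^ 2 ≤ m ^ (2 * (1 - s)) := by
    rw [← Real.rpow_two]
    rcases hm0.eq_or_lt with h | h
    · rw [← h, Real.zero_rpow two_ne_zero]
      exact Real.rpow_nonneg le_rfl _
    · exact Real.rpow_le_rpow_of_exponent_ge h hm1 (by linarith)
  calc ‖ξ‖ ^ (2 * (1 : ℝ)) * m ^ 2
      = ‖ξ‖ ^ (2 * (1 - s)) * ‖ξ‖ ^ (2 * s) * m ^ 2 := by rw [← Real.rpow_add hξ0]; ring_nf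
    _ ≤ ‖ξ‖ ^ (2 * (1 - s)) * ‖ξ‖ ^ (2 * s) * m ^ (2 * (1 - s)) := by gcongr
    _ = (‖ξ‖ * m) ^ (2 * (1 - s)) * ‖ξ‖ ^ (2 * s) := by
      rw [Real.mul_rpow hξ0.le hm0]; ring
    _ ≤ _ := by gcongr

end Mollification

/-! ### Reduction of the variational problems to test functions -/

section TestReduction

theorem lintegral_enorm_sq_eq_eLpNorm {α F : Type*} [MeasurableSpace α] [NormedAddCommGroup F]
    (μ : Measure α) (f : α → F) : ∫⁻ x, ‖f x‖ₑ ^ 2 ∂μ = eLpNorm f 2 μ ^ 2 := by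
  have := eLpNorm_nnreal_pow_eq_lintegral (f := f) (μ := μ) (p := 2) (by norm_num)
  simpa using this.symm

/-- Minkowski's inequality in $L^2$. The strict inequality on the limit leaves the room needed for a
bound at finite $n$. -/
theorem eventually_lintegral_sq_le {α F : Type*} [MeasurableSpace α] [NormedAddCommGroup F]
    {μ : Measure α} {f : ℕ → α → F} {g : α → F} (hf : ∀ n, AEStronglyMeasurable (f n) μ)
    (hg : AEStronglyMeasurable g μ)
    (h : Tendsto (fun n => ∫⁻ x, ‖f n x - g x‖ₑ ^ 2 ∂μ) atTop (𝓝 0)) {B : ℝ≥0∞}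
    (hB : ∫⁻ x, ‖g x‖ₑ ^ 2 ∂μ < B) : ∀ᶠ n in atTop, ∫⁻ x, ‖f n x‖ₑ ^ 2 ∂μ ≤ B := by
  simp_rw [lintegral_enorm_sq_eq_eLpNorm] at hB ⊢
  have h1 : Tendsto (fun n => eLpNorm (fun x => f n x - g x) 2 μ) atTop (𝓝 0) := by
    have h2 := h.ennrpow_const (1 / 2)
    simp_rw [lintegral_enorm_sq_eq_eLpNorm] at h2
    have h3 : ∀ a : ℝ≥0∞, (a ^ 2) ^ (1 / 2 : ℝ) = a := fun a => by
      rw [← ENNReal.rpow_two, ← ENNReal.rpow_mul]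
      norm_num
    simp_rw [h3] at h2
    simpa using h2
  have h3 : Tendsto (fun n => (eLpNorm (fun x => f n x - g x) 2 μ + eLpNorm g 2 μ) ^ 2) atTop
      (𝓝 ((0 + eLpNorm g 2 μ) ^ 2)) :=
    ENNReal.Tendsto.pow (h1.add tendsto_const_nhds)
  rw [zero_add] at h3
  filter_upwards [h3.eventually_lt_const hB] with n hn
  refine le_trans ?_ hn.le
  gcongr
  have := eLpNorm_add_le ((hf n).sub hg) hg (p := 2) (by norm_num)
  rw [sub_add_cancel] at this
  exact this

variable {N : ℕ} {Ω : Set (EuclideanSpace ℝ (Fin N))} {u v : EuclideanSpace ℝ (Fin N) → ℝ}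

theorem IsTestFunction.memLp (hu : IsTestFunction Ω u) (p : ℝ≥0∞)
    (μ : Measure (EuclideanSpace ℝ (Fin N))) [IsFiniteMeasureOnCompacts μ] : MemLp u p μ :=
  hu.continuous.memLp_of_hasCompactSupport hu.compact

theorem IsTestFunction.continuous_gradient (hu : IsTestFunction Ω u) :
    Continuous (gradient u) :=
  (InnerProductSpace.toDual ℝ _).symm.continuous.comp (hu.smooth.continuous_fderiv (by simp))

theorem IsTestFunction.gradient_eq_zero (hu : IsTestFunction Ω u)
    {x : EuclideanSpace ℝ (Fin N)} (hx : x ∉ Ω) : gradient u x = 0 := by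
  have : fderiv ℝ u x = 0 := by
    by_contra h
    exact hx (hu.support (support_fderiv_subset ℝ (f := u) h))
  simp [gradient, this]

theorem IsTestFunction.hasWeakGradient (hu : IsTestFunction univ u) :
    HasWeakGradient u (gradient u) where
  locInt := hu.continuous.locallyIntegrable
  locInt_grad := hu.continuous_gradient.locallyIntegrable
  byParts := by
    intro ψ hψ v
    simp_rw [inner_gradient_left]
    have hd := hu.smooth.differentiable (by simp)
    have hd' := hψ.smooth.differentiable (by simp)
    refine integral_mul_fderiv_eq_neg_fderiv_mul_of_integrable ?_ ?_ ?_ (fun x _ => hd x)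
      (fun x _ => hd' x)
    · exact ((hu.fderiv_apply v).continuous.mul hψ.continuous).integrable_of_hasCompactSupport
        hψ.compact.mul_left
    · exact (hu.continuous.mul (hψ.fderiv_apply v).continuous).integrable_of_hasCompactSupport
        hu.compact.mul_right
    · exact (hu.continuous.mul hψ.continuous).integrable_of_hasCompactSupport hu.compact.mul_right

theorem tendstoL1loc_const (u : EuclideanSpace ℝ (Fin N) → ℝ) : TendstoL1loc (fun _ => u) u :=
  fun K _ => by simp

theorem IsTestFunction.memD0 (hu : IsTestFunction Ω u) : MemD0 Ω u :=
  ⟨gradient u, hu.to_univ.hasWeakGradient, fun _ => u, fun _ => hu, by simp,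
    tendstoL1loc_const u⟩

theorem IsTestFunction.memFracD0 (hu : IsTestFunction Ω u) (s : ℝ) : MemFracD0 s Ω u :=
  ⟨hu.continuous.aestronglyMeasurable, fun _ => u, fun _ => hu, by simp [gagliardoSq],
    tendstoL1loc_const u⟩

theorem gradient_const_mul (hu : IsTestFunction Ω u) (c : ℝ) (x : EuclideanSpace ℝ (Fin N)) :
    gradient (fun x => c * u x) x = c • gradient u x := by
  have hd := hu.smooth.differentiable (by simp) x
  simp [gradient, fderiv_const_mul hd]

theorem gagliardoSq_const_mul (s c : ℝ) (u : EuclideanSpace ℝ (Fin N) → ℝ) :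
    gagliardoSq s (fun x => c * u x) = ‖c‖ₑ ^ 2 * gagliardoSq s u := by
  rw [gagliardoSq, gagliardoSq, ← lintegral_const_mul' _ _ (by simp)]
  congr 1 with z
  rw [← ofReal_norm, ← ENNReal.ofReal_pow (norm_nonneg _), ← ENNReal.ofReal_mul (by positivity),
    Real.norm_eq_abs, sq_abs]
  ring_nf

/-- Normalization by $c=1/n$. For $n=0$ the left side is $0$ even when $L=\infty$. -/
theorem mul_sq_le_of_homogeneous {L n I : ℝ≥0∞} (hn : n ≠ ⊤)
    (h : ∀ c : ℝ, ‖c‖ₑ * n = 1 → L ≤ ‖c‖ₑ ^ 2 * I) : L * n ^ 2 ≤ I := by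
  rcases eq_or_ne n 0 with rfl | hn0
  · simp
  · have hc : ‖n.toReal⁻¹‖ₑ = n⁻¹ := by
      rw [Real.enorm_eq_ofReal (by positivity), ENNReal.ofReal_inv_of_pos
        (ENNReal.toReal_pos hn0 hn), ENNReal.ofReal_toReal hn]
    have := h n.toReal⁻¹ (by rw [hc, ENNReal.inv_mul_cancel hn0 hn])
    rw [hc] at this
    calc L * n ^ 2 ≤ n⁻¹ ^ 2 * I * n ^ 2 := by gcongr
      _ = (n⁻¹ * n) ^ 2 * I := by ring
      _ = I := by rw [ENNReal.inv_mul_cancel hn0 hn]; simp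

theorem eLpNorm_const_mul_real {α : Type*} [MeasurableSpace α] (μ : Measure α) (p : ℝ≥0∞) (c : ℝ)
    (u : α → ℝ) : eLpNorm (fun x => c * u x) p μ = ‖c‖ₑ * eLpNorm u p μ :=
  eLpNorm_const_smul c u p μ

theorem IsTestFunction.poincareSobolev_mul_le (hu : IsTestFunction Ω u) (q : ℝ) :
    poincareSobolev q Ω * eLpNorm u (ENNReal.ofReal q) (volume.restrict Ω) ^ 2 ≤
      ∫⁻ x in Ω, ‖gradient u x‖ₑ ^ 2 := by
  refine mul_sq_le_of_homogeneous (hu.memLp _ _).eLpNorm_ne_top fun c hc => ?_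
  refine sInf_le ⟨fun x => c * u x, gradient fun x => c * u x, (hu.const_mul c).memD0,
    (hu.const_mul c).to_univ.hasWeakGradient, ?_, ?_⟩
  · rw [eLpNorm_const_mul_real, hc]
  · simp_rw [gradient_const_mul hu, enorm_smul, mul_pow]
    rw [lintegral_const_mul' _ _ (by simp)]

theorem IsTestFunction.fracPoincareSobolev_mul_le (hu : IsTestFunction Ω u) (s q : ℝ) :
    fracPoincareSobolev s q Ω * eLpNorm u (ENNReal.ofReal q) (volume.restrict Ω) ^ 2 ≤
      gagliardoSq s u := by
  refine mul_sq_le_of_homogeneous (hu.memLp _ _).eLpNorm_ne_top fun c hc => ?_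
  refine sInf_le ⟨fun x => c * u x, (hu.const_mul c).memFracD0 s, ?_,
    (gagliardoSq_const_mul s c u).symm⟩
  rw [eLpNorm_const_mul_real, hc]

/-- The closure of $\Omega$ is compact, so a subsequence converges almost everywhere on it and
Fatou's lemma applies. Lower semicontinuity is all that is needed: a larger norm of the approximants
only lowers their quotient. -/
theorem TendstoL1loc.exists_subseq {φ : ℕ → EuclideanSpace ℝ (Fin N) → ℝ}
    (hφ : ∀ n, IsTestFunction Ω (φ n)) (hu : AEStronglyMeasurable u volume)
    (h : TendstoL1loc φ u) (hb : Bornology.IsBounded Ω) (p : ℝ≥0∞) :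
    ∃ ns : ℕ → ℕ, StrictMono ns ∧ eLpNorm u p (volume.restrict Ω) ≤
      liminf (fun n => eLpNorm (φ (ns n)) p (volume.restrict Ω)) atTop := by
  have h1 := h (closure Ω) hb.isCompact_closure
  have hm := tendstoInMeasure_of_tendsto_eLpNorm (μ := volume.restrict (closure Ω)) one_ne_zero
    (fun n => (hφ n).continuous.aestronglyMeasurable) hu.restrict (l := atTop)
    (by simpa [eLpNorm_one_eq_lintegral_enorm] using h1)
  obtain ⟨ns, hns, hae⟩ := hm.exists_seq_tendsto_ae
  refine ⟨ns, hns, Lp.eLpNorm_lim_le_liminf_eLpNorm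
    (fun n => (hφ _).continuous.aestronglyMeasurable) _ ?_⟩
  exact ae_restrict_of_ae_restrict_of_subset subset_closure hae

/-- The difference quotient whose `L²` norm is the Gagliardo seminorm. -/
noncomputable def gagliardoQuotient (s : ℝ) (u : EuclideanSpace ℝ (Fin N) → ℝ)
    (z : EuclideanSpace ℝ (Fin N) × EuclideanSpace ℝ (Fin N)) : ℝ :=
  (u z.1 - u z.2) / ‖z.1 - z.2‖ ^ (((N : ℝ) + 2 * s) / 2)

theorem gagliardoSq_eq_lintegral_quotient (s : ℝ) (u : EuclideanSpace ℝ (Fin N) → ℝ) :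
    gagliardoSq s u = ∫⁻ z, ‖gagliardoQuotient s u z‖ₑ ^ 2 := by
  rw [gagliardoSq]
  congr 1 with z
  rw [← ofReal_norm, ← ENNReal.ofReal_pow (norm_nonneg _), Real.norm_eq_abs, sq_abs,
    gagliardoQuotient, div_pow, ← Real.rpow_natCast (‖z.1 - z.2‖ ^ _),
    ← Real.rpow_mul (norm_nonneg _)]
  norm_num

theorem aestronglyMeasurable_gagliardoQuotient (s : ℝ) (hu : AEStronglyMeasurable u volume) :
    AEStronglyMeasurable (gagliardoQuotient s u) volume := by
  have h1 : AEStronglyMeasurable (fun z : EuclideanSpace ℝ (Fin N) × EuclideanSpace ℝ (Fin N) =>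
      u z.1) volume := hu.comp_fst
  have h2 : AEStronglyMeasurable (fun z : EuclideanSpace ℝ (Fin N) × EuclideanSpace ℝ (Fin N) =>
      u z.2) volume := hu.comp_snd
  have h3 : Measurable fun z : EuclideanSpace ℝ (Fin N) × EuclideanSpace ℝ (Fin N) =>
      (‖z.1 - z.2‖ ^ (((N : ℝ) + 2 * s) / 2))⁻¹ := by fun_prop
  exact (h1.sub h2).mul h3.aestronglyMeasurable

theorem MemFracD0.exists_testFunction {s : ℝ} (h : MemFracD0 s Ω u) (hb : Bornology.IsBounded Ω)
    (p : ℝ≥0∞) {a B : ℝ≥0∞} (ha : a < eLpNorm u p (volume.restrict Ω))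
    (hB : gagliardoSq s u < B) :
    ∃ φ, IsTestFunction Ω φ ∧ gagliardoSq s φ ≤ B ∧
      a < eLpNorm φ p (volume.restrict Ω) := by
  obtain ⟨φ, hφ, hlim, hloc⟩ := h.approx
  obtain ⟨ns, hns, hle⟩ := hloc.exists_subseq hφ h.aesm hb p
  have hB' := hB
  simp_rw [gagliardoSq_eq_lintegral_quotient] at hlim hB'
  have hdiff : ∀ n z, gagliardoQuotient s (fun x => φ n x - u x) z =
      gagliardoQuotient s (φ n) z - gagliardoQuotient s u z := fun n z => by
    simp only [gagliardoQuotient]; ring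
  simp_rw [hdiff] at hlim
  have h1 := eventually_lintegral_sq_le (fun n => aestronglyMeasurable_gagliardoQuotient s
    (hφ n).continuous.aestronglyMeasurable) (aestronglyMeasurable_gagliardoQuotient s h.aesm)
    hlim hB'
  have h2 := eventually_lt_of_lt_liminf (ha.trans_le hle)
  obtain ⟨n, hn1, hn2⟩ := ((hns.tendsto_atTop.eventually h1).and h2).exists
  exact ⟨φ (ns n), hφ _, by rwa [gagliardoSq_eq_lintegral_quotient], hn2⟩

/-- Identifies the gradient appearing in the energy of a competitor with the one that witnesses its
membership in the completion. -/
theorem HasWeakGradient.ae_eq {G G' : EuclideanSpace ℝ (Fin N) → EuclideanSpace ℝ (Fin N)}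
    (h : HasWeakGradient u G) (h' : HasWeakGradient u G') : G =ᵐ[volume] G' := by
  refine ae_eq_of_integral_contDiff_smul_eq h.locInt_grad h'.locInt_grad fun ψ hψ hψc => ?_
  refine ext_inner_left ℝ fun v => ?_
  have hi := h.locInt_grad.integrable_smul_left_of_hasCompactSupport hψ.continuous hψc
  have hi' := h'.locInt_grad.integrable_smul_left_of_hasCompactSupport hψ.continuous hψc
  rw [← integral_inner hi, ← integral_inner hi']
  have e := h.byParts ψ (isTestFunction_univ_iff.2 ⟨hψ, hψc⟩) v
  have e' := h'.byParts ψ (isTestFunction_univ_iff.2 ⟨hψ, hψc⟩) v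
  have := neg_injective (e.symm.trans e')
  have key : ∀ (F : EuclideanSpace ℝ (Fin N)) (c : ℝ), inner ℝ v (c • F) = inner ℝ F v * c :=
    fun F c => by rw [real_inner_smul_right, real_inner_comm, mul_comm]
  simp_rw [key]
  exact this

theorem MemD0.exists_testFunction (h : MemD0 Ω u) (hΩ : MeasurableSet Ω)
    (hb : Bornology.IsBounded Ω) {G : EuclideanSpace ℝ (Fin N) → EuclideanSpace ℝ (Fin N)}
    (hG : HasWeakGradient u G) (p : ℝ≥0∞) {a B : ℝ≥0∞}
    (ha : a < eLpNorm u p (volume.restrict Ω)) (hB : ∫⁻ x in Ω, ‖G x‖ₑ ^ 2 < B) :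
    ∃ φ, IsTestFunction Ω φ ∧ ∫⁻ x, ‖gradient φ x‖ₑ ^ 2 ≤ B ∧
      a < eLpNorm φ p (volume.restrict Ω) := by
  obtain ⟨G', hG', φ, hφ, hlim, hloc⟩ := h
  obtain ⟨ns, hns, hle⟩ := hloc.exists_subseq hφ hG'.locInt.aestronglyMeasurable hb p
  -- The gradients of the approximants vanish off $\Omega$, hence so does their $L^2$ limit; the
  -- energy on $\Omega$ is thus the energy on the whole space.
  have hcompl : ∫⁻ x in Ωᶜ, ‖G' x‖ₑ ^ 2 = 0 := by
    refine le_antisymm (ge_of_tendsto' hlim fun n => ?_) zero_le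
    refine le_trans (le_of_eq ?_) (setLIntegral_le_lintegral Ωᶜ _)
    refine setLIntegral_congr_fun hΩ.compl fun x hx => ?_
    simp [(hφ n).gradient_eq_zero hx]
  have hB' : ∫⁻ x, ‖G' x‖ₑ ^ 2 < B := by
    rw [← lintegral_add_compl _ hΩ, hcompl, add_zero]
    refine lt_of_eq_of_lt (lintegral_congr_ae (ae_restrict_of_ae ?_)) hB
    exact (hG'.ae_eq hG).mono fun x hx => by simp only [hx]
  have h1 := eventually_lintegral_sq_le (fun n =>
    (hφ n).continuous_gradient.aestronglyMeasurable) hG'.locInt_grad.aestronglyMeasurable hlim hB'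
  have h2 := eventually_lt_of_lt_liminf (ha.trans_le hle)
  obtain ⟨n, hn1, hn2⟩ := ((hns.tendsto_atTop.eventually h1).and h2).exists
  exact ⟨φ (ns n), hφ _, hn1, hn2⟩

end TestReduction

/-! ### Asymptotics of the Gagliardo seminorm and the upper bound -/

section UpperBound

variable {N : ℕ} {Ω : Set (EuclideanSpace ℝ (Fin N))} {u : EuclideanSpace ℝ (Fin N) → ℝ}

theorem IsTestFunction.fracEnergy_zero_ne_top (hu : IsTestFunction univ u) :
    fracEnergy 0 u ≠ ⊤ := by
  rw [hu.fracEnergy_zero, lintegral_enorm_sq_eq_eLpNorm]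
  exact ENNReal.pow_ne_top (hu.memLp 2 volume).eLpNorm_ne_top

theorem IsTestFunction.lintegral_gradient_sq_ne_top (hu : IsTestFunction univ u) :
    ∫⁻ x, ‖gradient u x‖ₑ ^ 2 ≠ ⊤ := by
  rw [lintegral_enorm_sq_eq_eLpNorm]
  refine ENNReal.pow_ne_top (hu.continuous_gradient.memLp_of_hasCompactSupport ?_).eLpNorm_ne_top
  exact (hu.compact.fderiv ℝ).comp_left (map_zero (InnerProductSpace.toDual ℝ _).symm)

theorem IsTestFunction.fracEnergy_one_ne_top (hu : IsTestFunction univ u) :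
    fracEnergy 1 u ≠ ⊤ := by
  intro h
  have h1 := hu.lintegral_gradient_sq_ne_top
  rw [hu.lintegral_gradient_sq, h] at h1
  exact h1 (ENNReal.mul_top (ENNReal.ofReal_pos.2 (by positivity)).ne')

theorem rpow_two_mul_le_one_add_sq {r s : ℝ} (hr : 0 ≤ r) (hs0 : 0 ≤ s) (hs1 : s ≤ 1) :
    r ^ (2 * s) ≤ 1 + r ^ 2 := by
  rcases le_total r 1 with h | h
  · have := Real.rpow_le_one hr h (by linarith : 0 ≤ 2 * s)
    nlinarith
  · have := Real.rpow_le_rpow_of_exponent_le h (by linarith : 2 * s ≤ 2)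
    rw [Real.rpow_two] at this
    linarith

theorem IsTestFunction.tendsto_fracEnergy [NeZero N] (hu : IsTestFunction univ u) :
    Tendsto (fun s => fracEnergy s u) (𝓝[<] 1) (𝓝 (fracEnergy 1 u)) := by
  have hF : Measurable (fourierReal u) := hu.continuous_fourierReal.measurable
  -- Dominated convergence, with $|\xi|^{2s}\le1+|\xi|^2$ for $0\le s\le1$.
  refine tendsto_lintegral_filter_of_dominated_convergence
    (fun ξ => ENNReal.ofReal (‖ξ‖ ^ (2 * (0 : ℝ))) * ‖fourierReal u ξ‖ₑ ^ 2 +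
      ENNReal.ofReal (‖ξ‖ ^ (2 * (1 : ℝ))) * ‖fourierReal u ξ‖ₑ ^ 2)
    (Eventually.of_forall fun s => by fun_prop) ?_ ?_ ?_
  · filter_upwards [self_mem_nhdsWithin, mem_nhdsWithin_of_mem_nhds (lt_mem_nhds one_pos)]
      with s hs1 hs0
    refine ae_of_all _ fun ξ => ?_
    rw [← add_mul, ← ENNReal.ofReal_add (by positivity) (by positivity)]
    gcongr
    simpa using rpow_two_mul_le_one_add_sq (norm_nonneg ξ) (le_of_lt hs0) (le_of_lt hs1)
  · rw [lintegral_add_left (by fun_prop)]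
    exact ENNReal.add_ne_top.2 ⟨hu.fracEnergy_zero_ne_top, hu.fracEnergy_one_ne_top⟩
  · refine ae_ne_zero.mono fun ξ hξ => ?_
    refine ENNReal.Tendsto.mul_const (ENNReal.tendsto_ofReal ?_) (Or.inr (by simp))
    have : ContinuousAt (fun s : ℝ => ‖ξ‖ ^ (2 * s)) 1 :=
      (Real.continuousAt_const_rpow (norm_pos_iff.2 hξ).ne').comp
        (f := fun s : ℝ => 2 * s) (by fun_prop)
    exact this.tendsto.mono_left nhdsWithin_le_nhds

theorem exists_norm_eq_one [NeZero N] : ∃ e : EuclideanSpace ℝ (Fin N), ‖e‖ = 1 :=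
  exists_norm_eq _ zero_le_one

theorem unitBallVolume_ne_top (N : ℕ) : unitBallVolume N ≠ ⊤ := measure_ball_lt_top.ne

theorem unitBallVolume_ne_zero (N : ℕ) : unitBallVolume N ≠ 0 :=
  (Metric.measure_ball_pos _ _ one_pos).ne'

theorem half_unitBallVolume_mul (N : ℕ) (H : ℝ≥0∞) :
    unitBallVolume N / 2 * (ENNReal.ofReal (4 * Real.pi ^ 2) * H) =
      ENNReal.ofReal (2 * Real.pi ^ 2) * unitBallVolume N * H := by
  have : ENNReal.ofReal (4 * Real.pi ^ 2) = 2 * ENNReal.ofReal (2 * Real.pi ^ 2) := by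
    rw [← ENNReal.ofReal_ofNat, ← ENNReal.ofReal_mul (by norm_num)]
    ring_nf
  rw [this, ENNReal.div_eq_inv_mul]
  calc _ = (2⁻¹ * 2) * (ENNReal.ofReal (2 * Real.pi ^ 2) * unitBallVolume N * H) := by ring
    _ = _ := by rw [ENNReal.inv_mul_cancel (by norm_num) (by norm_num), one_mul]

/-- The Bourgain–Brezis–Mironescu formula for test functions. -/
theorem IsTestFunction.tendsto_gagliardoSq [NeZero N] (hu : IsTestFunction univ u) :
    Tendsto (fun s => ENNReal.ofReal (1 - s) * gagliardoSq s u) (𝓝[<] 1)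
      (𝓝 (unitBallVolume N / 2 * ∫⁻ x, ‖gradient u x‖ₑ ^ 2)) := by
  obtain ⟨e, he⟩ := exists_norm_eq_one (N := N)
  rw [hu.lintegral_gradient_sq, half_unitBallVolume_mul]
  have h := ENNReal.Tendsto.mul (tendsto_mul_fracSymbol he) (Or.inr hu.fracEnergy_one_ne_top)
    hu.tendsto_fracEnergy (Or.inr (ENNReal.mul_ne_top ENNReal.ofReal_ne_top
      (unitBallVolume_ne_top N)))
  refine h.congr' ?_
  filter_upwards [mem_nhdsWithin_of_mem_nhds (lt_mem_nhds one_pos)] with s hs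
  rw [hu.gagliardoSq_eq hs he, mul_assoc]

/-- An almost optimal test function for the local problem is a competitor at every order $s$, and
its fractional energies converge. Its norm is only known to exceed $a<1$, so $a$ tends to $1$ at the
end. -/
theorem limsup_fracPoincareSobolev_le [NeZero N] (q : ℝ) (hΩ : IsOpen Ω)
    (hb : Bornology.IsBounded Ω) :
    limsup (fun s : ℝ => ENNReal.ofReal (1 - s) * fracPoincareSobolev s q Ω) (𝓝[<] 1)
        ≤ unitBallVolume N / 2 * poincareSobolev q Ω := by
  set L := limsup (fun s : ℝ => ENNReal.ofReal (1 - s) * fracPoincareSobolev s q Ω) (𝓝[<] 1)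
    with hL
  set w := unitBallVolume N / 2 with hw
  have hw0 : w ≠ 0 := by simp [hw, ENNReal.div_eq_zero_iff, unitBallVolume_ne_zero]
  have hwt : w ≠ ⊤ := ENNReal.div_ne_top (unitBallVolume_ne_top N) (by norm_num)
  rw [← ENNReal.div_le_iff' hw0 hwt]
  refine le_sInf ?_
  rintro E ⟨u, G, hu, hG, hn, rfl⟩
  refine le_of_forall_gt_imp_ge_of_dense fun B hB => ?_
  rw [ENNReal.div_le_iff' hw0 hwt]
  have key : ∀ a : ℝ≥0∞, a < 1 → L * a ^ 2 ≤ w * B := by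
    intro a ha
    obtain ⟨φ, hφ, hφB, hφa⟩ := hu.exists_testFunction hΩ.measurableSet hb hG
      (ENNReal.ofReal q) (hn.symm ▸ ha) hB
    rcases eq_or_ne a 0 with rfl | ha0
    · simp
    have ha2 : a ^ 2 ≠ 0 := pow_ne_zero _ ha0
    have hat : a ^ 2 ≠ ⊤ := ENNReal.pow_ne_top ha.ne_top
    rw [← ENNReal.le_div_iff_mul_le (Or.inl ha2) (Or.inl hat)]
    have h1 : Tendsto (fun s => ENNReal.ofReal (1 - s) * gagliardoSq s φ / a ^ 2) (𝓝[<] 1)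
        (𝓝 (w * (∫⁻ x, ‖gradient φ x‖ₑ ^ 2) / a ^ 2)) :=
      ENNReal.Tendsto.div_const hφ.to_univ.tendsto_gagliardoSq (Or.inr ha2)
    calc L ≤ limsup (fun s => ENNReal.ofReal (1 - s) * gagliardoSq s φ / a ^ 2) (𝓝[<] 1) := by
          refine limsup_le_limsup (Eventually.of_forall fun s => ?_)
          simp only
          rw [ENNReal.le_div_iff_mul_le (Or.inl ha2) (Or.inl hat), mul_assoc]
          gcongr
          refine le_trans ?_ (hφ.fracPoincareSobolev_mul_le s q)
          gcongr
      _ = w * (∫⁻ x, ‖gradient φ x‖ₑ ^ 2) / a ^ 2 := h1.limsup_eq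
      _ ≤ _ := by gcongr
  have hlim : Tendsto (fun a : ℝ≥0∞ => L * a ^ 2) (𝓝[<] 1) (𝓝 (L * 1 ^ 2)) :=
    ENNReal.Tendsto.const_mul (ENNReal.Tendsto.pow (tendsto_id.mono_left nhdsWithin_le_nhds))
      (Or.inl (by simp))
  rw [one_pow, mul_one] at hlim
  have : (𝓝[<] (1 : ℝ≥0∞)).NeBot := nhdsLT_neBot_of_exists_lt ⟨0, zero_lt_one⟩
  exact le_of_tendsto hlim (eventually_mem_nhdsWithin.mono fun a ha => key a ha)

end UpperBound

open scoped Manifold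

/-! ### Lipschitz domains: inward translations and partitions of unity -/

section Geometry

variable {N : ℕ} {Ω : Set (EuclideanSpace ℝ (Fin N))}

/-- The points of `U` are moved by `ε • d` deeper into `Ω`, in the sense that a point of `U` from
which a point `κ ε`-close to `Ω` is reached by the translation `-ε • d` lies in `Ω`. -/
def IsInwardDirection (Ω U : Set (EuclideanSpace ℝ (Fin N))) (d : EuclideanSpace ℝ (Fin N))
    (κ ε₀ : ℝ) : Prop :=
  ∀ ε, 0 < ε → ε < ε₀ → ∀ z ∈ U, ∀ y ∈ Ω, ‖z - ε • d - y‖ ≤ κ * ε → z ∈ Ω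

theorem HasLipschitzBoundary.exists_isInwardDirection (hL : HasLipschitzBoundary Ω)
    (hΩ : IsOpen Ω) {x : EuclideanSpace ℝ (Fin N)} (hx : x ∈ closure Ω) :
    ∃ r > 0, ∃ d : EuclideanSpace ℝ (Fin N), ‖d‖ ≤ 1 ∧ ∃ κ > 0, ∃ ε₀ > 0,
      IsInwardDirection Ω (Metric.ball x r) d κ ε₀ := by
  by_cases hxΩ : x ∈ Ω
  · obtain ⟨r, hr, hball⟩ := Metric.isOpen_iff.1 hΩ x hxΩ
    -- Near an interior point the zero direction suffices: the whole ball lies in $\Omega$.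
    exact ⟨r, hr, 0, by simp, 1, one_pos, 1, one_pos, fun ε _ _ z hz _ _ _ => hball hz⟩
  · have hfr : x ∈ frontier Ω := ⟨hx, by rwa [hΩ.interior_eq]⟩
    obtain ⟨r, hr, e, he, K, g, hg, hiff⟩ := hL x hfr
    have hK : (0 : ℝ) ≤ K := K.2
    -- With $y=z+\varepsilon e+a$ and $|a|\le\kappa\varepsilon$, the height of $y$ exceeds that of
    -- $z$ by at least $\varepsilon-\kappa\varepsilon$, while the graph rises by at most
    -- $2K\kappa\varepsilon$, so $(2K+1)\kappa=1$ is what is needed. The radius $r/2$ and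
    -- $\varepsilon<r/4$ keep $y$ in the ball where $\Omega$ is described by the graph.
    have hκ : 0 < 1 / (2 * (K : ℝ) + 1) := by positivity
    refine ⟨r / 2, by positivity, -e, by simp [he], 1 / (2 * (K : ℝ) + 1), hκ, r / 4,
      by positivity, fun ε hε hεr z hz y hy hzy => ?_⟩
    have hκ1 : 1 / (2 * (K : ℝ) + 1) ≤ 1 := by
      rw [div_le_one (by positivity)]
      linarith
    set κ := 1 / (2 * (K : ℝ) + 1) with hκdef
    set a := y - z - ε • e with ha
    have ha' : ‖a‖ ≤ κ * ε := by
      have e1 : z - ε • -e - y = -a := by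
        rw [ha, smul_neg]
        abel
      rwa [e1, norm_neg] at hzy
    have hy_eq : y = z + ε • e + a := by rw [ha]; abel
    have hzr : ‖z - x‖ < r / 2 := by simpa [dist_eq_norm] using hz
    have hκε : κ * ε ≤ ε := by nlinarith
    have hyball : y ∈ Metric.ball x r := by
      rw [Metric.mem_ball, dist_eq_norm, hy_eq, show z + ε • e + a - x = (z - x) + ε • e + a by abel]
      refine (norm_add₃_le).trans_lt ?_
      rw [norm_smul, he, Real.norm_of_nonneg hε.le]
      linarith
    have hzball : z ∈ Metric.ball x r := Metric.ball_subset_ball (by linarith) hz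
    have hey : inner ℝ e y = inner ℝ e z + ε + inner ℝ e a := by
      rw [hy_eq, inner_add_right, inner_add_right, real_inner_smul_right,
        real_inner_self_eq_norm_sq, he]
      ring
    have hlt := (hiff y hyball).1 hy
    have hea : |inner ℝ e a| ≤ κ * ε := by
      refine (abs_real_inner_le_norm e a).trans ?_
      rwa [he, one_mul]
    have hproj : y - (inner ℝ e y : ℝ) • e = (z - (inner ℝ e z : ℝ) • e) +
        (a - (inner ℝ e a : ℝ) • e) := by
      rw [hey, hy_eq]
      module
    have hgd := hg.dist_le_mul (y - (inner ℝ e y : ℝ) • e) (z - (inner ℝ e z : ℝ) • e)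
    rw [Real.dist_eq, dist_eq_norm, hproj, add_sub_cancel_left, ← hproj] at hgd
    have hnorm : ‖a - (inner ℝ e a : ℝ) • e‖ ≤ 2 * (κ * ε) := by
      refine (norm_sub_le _ _).trans ?_
      rw [norm_smul, he, mul_one, Real.norm_eq_abs]
      linarith
    have h1 : (K : ℝ) * ‖a - (inner ℝ e a : ℝ) • e‖ ≤ K * (2 * (κ * ε)) := by gcongr
    have h2 := (abs_le.1 hgd).2
    have h3 := (abs_le.1 hea).1
    have h4 : K * (2 * (κ * ε)) + κ * ε = ε := by
      rw [hκdef]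
      field_simp
    refine (hiff z hzball).2 ?_
    linarith

theorem Finset.exists_pos_le_of_forall_pos {α : Type*} (t : Finset α) {f : α → ℝ}
    (hf : ∀ x ∈ t, 0 < f x) : ∃ c > 0, ∀ x ∈ t, c ≤ f x := by
  rcases t.eq_empty_or_nonempty with rfl | ht
  · exact ⟨1, one_pos, by simp⟩
  · obtain ⟨x, hx, hmin⟩ := t.exists_min_image f ht
    exact ⟨f x, hf x hx, hmin⟩

/-- A finite partition of unity on a bounded Lipschitz domain `Ω` together with inward
translations on the supports of its members. -/
structure InwardPartition (Ω : Set (EuclideanSpace ℝ (Fin N)))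
    (t : Finset (EuclideanSpace ℝ (Fin N)))
    (η : t → EuclideanSpace ℝ (Fin N) → ℝ) (d : t → EuclideanSpace ℝ (Fin N))
    (κ ε₀ L : ℝ) : Prop where
  isTest : ∀ i, IsTestFunction univ (η i)
  nonneg : ∀ i x, 0 ≤ η i x
  sum_le_one : ∀ x, ∑ i, η i x ≤ 1
  sum_eq_one : ∀ x ∈ Ω, ∑ i, η i x = 1
  norm_le_one : ∀ i, ‖d i‖ ≤ 1
  κ_pos : 0 < κ
  κ_le_one : κ ≤ 1
  ε₀_pos : 0 < ε₀
  inward : ∀ i, IsInwardDirection Ω (tsupport (η i)) (d i) κ ε₀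
  L_nonneg : 0 ≤ L
  abs_sub_le : ∀ i x y, |η i x - η i y| ≤ L * ‖x - y‖
  norm_gradient_le : ∀ i x, ‖gradient (η i) x‖ ≤ L

theorem IsTestFunction.exists_lipschitz {u : EuclideanSpace ℝ (Fin N) → ℝ}
    (hu : IsTestFunction univ u) : ∃ L : ℝ, 0 ≤ L ∧ (∀ x y, |u x - u y| ≤ L * ‖x - y‖) ∧
      ∀ x, ‖gradient u x‖ ≤ L := by
  obtain ⟨C, hC⟩ := ContDiff.lipschitzWith_of_hasCompactSupport hu.compact hu.smooth (by simp)
  refine ⟨C, C.2, fun x y => ?_, fun x => ?_⟩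
  · simpa [Real.dist_eq, dist_eq_norm] using hC.dist_le_mul x y
  · have := norm_fderiv_le_of_lipschitz ℝ hC (x₀ := x)
    simpa [gradient] using this

/-- Finitely many charts cover the compact closure. The inward property survives shrinking $\kappa$
and $\varepsilon_0$, so the minima over the charts serve for all of them. -/
theorem HasLipschitzBoundary.exists_inwardPartition (hL : HasLipschitzBoundary Ω)
    (hΩ : IsOpen Ω) (hb : Bornology.IsBounded Ω) :
    ∃ t η d κ ε₀ L, InwardPartition (N := N) Ω t η d κ ε₀ L := by
  have hex := fun x (hx : x ∈ closure Ω) => hL.exists_isInwardDirection hΩ hx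
  choose! r hr d hd κ hκ ε₀ hε₀ hin using hex
  obtain ⟨t, ht, hcover⟩ := hb.isCompact_closure.elim_nhds_subcover (fun x => Metric.ball x (r x))
    fun x hx => Metric.ball_mem_nhds x (hr x hx)
  obtain ⟨κ', hκ'0, hκ'⟩ := t.exists_pos_le_of_forall_pos fun x hx => hκ x (ht x hx)
  obtain ⟨ε', hε'0, hε'⟩ := t.exists_pos_le_of_forall_pos fun x hx => hε₀ x (ht x hx)
  obtain ⟨f, hf⟩ := SmoothPartitionOfUnity.exists_isSubordinate
    𝓘(ℝ, EuclideanSpace ℝ (Fin N)) (isClosed_closure (s := Ω))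
    (fun i : t => Metric.ball (i : EuclideanSpace ℝ (Fin N)) (r i)) (fun i => Metric.isOpen_ball)
    (hcover.trans (by simp [iUnion_subtype]))
  have htest : ∀ i, IsTestFunction univ (f i) := fun i =>
    isTestFunction_univ_iff.2 ⟨(f i).contMDiff.contDiff,
      (Metric.isBounded_ball.subset (hf i)).isCompact_closure.of_isClosed_subset
        (isClosed_tsupport _) subset_closure⟩
  choose ℓ hℓ0 hℓ1 hℓ2 using fun i => (htest i).exists_lipschitz
  have hle : ∀ i, ℓ i ≤ ∑ j, ℓ j := fun i =>
    Finset.single_le_sum (fun j _ => hℓ0 j) (Finset.mem_univ i)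
  refine ⟨t, fun i => f i, fun i => d i, min κ' 1, ε', ∑ i, ℓ i,
    { isTest := htest
      nonneg := fun i x => f.nonneg i x
      sum_le_one := fun x => ?_
      sum_eq_one := fun x hx => ?_
      norm_le_one := fun i => hd i (ht i i.2)
      κ_pos := lt_min hκ'0 one_pos
      κ_le_one := min_le_right _ _
      ε₀_pos := hε'0
      inward := fun i ε hε hεε z hz y hy hzy => ?_
      L_nonneg := Finset.sum_nonneg fun j _ => hℓ0 j
      abs_sub_le := fun i x y => (hℓ1 i x y).trans
        (mul_le_mul_of_nonneg_right (hle i) (norm_nonneg _))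
      norm_gradient_le := fun i x => (hℓ2 i x).trans (hle i) }⟩
  · have := f.sum_le_one x
    rwa [finsum_eq_sum_of_fintype] at this
  · have := f.sum_eq_one (subset_closure hx)
    rwa [finsum_eq_sum_of_fintype] at this
  · refine hin i (ht i i.2) ε hε (hεε.trans_le (hε' i i.2)) z (hf i hz) y hy (hzy.trans ?_)
    gcongr
    exact (min_le_left _ _).trans (hκ' i i.2)

end Geometry

/-! ### The recovery map into test functions supported in a Lipschitz domain -/

section Recovery

variable {N : ℕ} {Ω : Set (EuclideanSpace ℝ (Fin N))}

theorem IsTestFunction.sum {ι : Type*} {f : ι → EuclideanSpace ℝ (Fin N) → ℝ} (s : Finset ι)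
    (hf : ∀ i, IsTestFunction Ω (f i)) : IsTestFunction Ω (fun x => ∑ i ∈ s, f i x) := by
  classical
  induction s using Finset.induction_on with
  | empty => exact ⟨by simpa using contDiff_const, by
      simp only [Finset.sum_empty]
      exact HasCompactSupport.zero, by
      simp [tsupport_eq_empty_iff.2 (rfl : (fun _ => (0 : ℝ)) = 0)]⟩
  | insert a s ha ih =>
    simp_rw [Finset.sum_insert ha]
    exact ⟨(hf a).smooth.add ih.smooth, (hf a).compact.add ih.compact,
      (tsupport_add _ _).trans (union_subset (hf a).support ih.support)⟩

/-- The function obtained by gluing the translates `w (· - ε • d i)`. -/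
noncomputable def glue {t : Finset (EuclideanSpace ℝ (Fin N))}
    (η : t → EuclideanSpace ℝ (Fin N) → ℝ) (d : t → EuclideanSpace ℝ (Fin N)) (ε : ℝ)
    (w : EuclideanSpace ℝ (Fin N) → ℝ) (x : EuclideanSpace ℝ (Fin N)) : ℝ :=
  ∑ i, η i x * w (x + -(ε • d i))

variable {t : Finset (EuclideanSpace ℝ (Fin N))} {η : t → EuclideanSpace ℝ (Fin N) → ℝ}
  {d : t → EuclideanSpace ℝ (Fin N)} {κ ε₀ L : ℝ}

/-- Mollification at radius $\kappa\varepsilon$ spreads the support by no more than the inward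
translation by $\varepsilon$ compensates. -/
theorem InwardPartition.isTestFunction_glue (hP : InwardPartition Ω t η d κ ε₀ L) {ε : ℝ}
    (hε : 0 < ε) (hε₀ : ε < ε₀) {ρ u : EuclideanSpace ℝ (Fin N) → ℝ}
    (hρ : IsMollifier (κ * ε) ρ) (hu : IsTestFunction Ω u) :
    IsTestFunction Ω (glue η d ε (mollify ρ u)) := by
  have hw := hρ.isTest.mollify hu.to_univ
  have hδ : 0 ≤ κ * ε := (mul_pos hP.κ_pos hε).le
  refine IsTestFunction.sum _ fun i => ?_
  refine ⟨(hP.isTest i).smooth.mul (hw.comp_add_right _).smooth, (hP.isTest i).compact.mul_right,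
    fun z hz => ?_⟩
  have h1 : z ∈ tsupport (η i) := tsupport_mul_subset_left hz
  have h2 : z + -(ε • d i) ∈ Metric.cthickening (κ * ε) (tsupport u) := by
    have hcl : IsClosed ((fun z => z + -(ε • d i)) ⁻¹'
        Metric.cthickening (κ * ε) (tsupport u)) :=
      Metric.isClosed_cthickening.preimage (by fun_prop)
    refine closure_minimal (fun x hx => ?_) hcl hz
    have hx' : mollify ρ u (x + -(ε • d i)) ≠ 0 := right_ne_zero_of_mul hx
    obtain ⟨y, hy, hxy⟩ := exists_of_mollify_ne_zero hρ hx'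
    exact Metric.mem_cthickening_of_dist_le _ y _ _ (subset_tsupport _ hy)
      (by rwa [dist_eq_norm])
  -- By compactness the distance to the support of $u$ is attained, which provides a point of
  -- $\Omega$ within exactly $\kappa\varepsilon$.
  rw [hu.compact.isCompact.cthickening_eq_biUnion_closedBall hδ] at h2
  simp only [mem_iUnion, exists_prop] at h2
  obtain ⟨y, hy, hyz⟩ := h2
  refine hP.inward i ε hε hε₀ z h1 y (hu.support hy) ?_
  rw [sub_eq_add_neg z]
  simpa [dist_eq_norm] using hyz

theorem norm_add_sq_le {F : Type*} [NormedAddCommGroup F] (a b : F) {θ : ℝ} (hθ : 0 < θ) :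
    ‖a + b‖ ^ 2 ≤ (1 + θ) * ‖a‖ ^ 2 + (1 + θ⁻¹) * ‖b‖ ^ 2 := by
  have h1 : ‖a + b‖ ^ 2 ≤ (‖a‖ + ‖b‖) ^ 2 := by gcongr; exact norm_add_le a b
  have h2 : 0 ≤ θ⁻¹ * (θ * ‖a‖ - ‖b‖) ^ 2 := by positivity
  have h3 : θ⁻¹ * (θ * ‖a‖ - ‖b‖) ^ 2 = θ * ‖a‖ ^ 2 - 2 * (‖a‖ * ‖b‖) + θ⁻¹ * ‖b‖ ^ 2 := by
    field_simp
    ring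
  nlinarith

theorem gradient_translate (w : EuclideanSpace ℝ (Fin N) → ℝ) (k x : EuclideanSpace ℝ (Fin N)) :
    gradient (fun x => w (x + k)) x = gradient w (x + k) := by
  simp [gradient, fderiv_comp_add_right]

/-- On $\Omega$ the gradients of the partition sum to zero, so the value $u(x)$ may be subtracted
from every coefficient. The terms where the derivative falls on the partition then contain only
small differences. -/
theorem InwardPartition.gradient_glue (hP : InwardPartition Ω t η d κ ε₀ L) (hΩ : IsOpen Ω)
    {w u : EuclideanSpace ℝ (Fin N) → ℝ} (hw : IsTestFunction univ w) (ε : ℝ)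
    {x : EuclideanSpace ℝ (Fin N)} (hx : x ∈ Ω) :
    gradient (glue η d ε w) x = ∑ i, η i x • gradient w (x + -(ε • d i)) +
      ∑ i, (w (x + -(ε • d i)) - u x) • gradient (η i) x := by
  have hdη : ∀ i, DifferentiableAt ℝ (η i) x := fun i =>
    (hP.isTest i).smooth.differentiable (by simp) x
  have hdw : ∀ i, DifferentiableAt ℝ (fun x => w (x + -(ε • d i))) x := fun i =>
    (hw.comp_add_right _).smooth.differentiable (by simp) x
  have h1 : ∑ i, gradient (η i) x = 0 := by
    have h2 : (fun x => ∑ i, η i x) =ᶠ[𝓝 x] fun _ => (1 : ℝ) := by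
      filter_upwards [hΩ.mem_nhds hx] with y hy using hP.sum_eq_one y hy
    have h3 := h2.fderiv_eq (𝕜 := ℝ)
    rw [fderiv_fun_sum fun i _ => hdη i, fderiv_fun_const] at h3
    simp only [gradient, ← map_sum, h3]
    simp
  have h4 : fderiv ℝ (glue η d ε w) x = ∑ i, (η i x • fderiv ℝ (fun x => w (x + -(ε • d i))) x +
      w (x + -(ε • d i)) • fderiv ℝ (η i) x) := by
    have : glue η d ε w = fun x => ∑ i, η i x * w (x + -(ε • d i)) := rfl
    rw [this, fderiv_fun_sum fun i _ => (hdη i).fun_mul (hdw i)]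
    exact Finset.sum_congr rfl fun i _ => fderiv_fun_mul (hdη i) (hdw i)
  have h5 : gradient (glue η d ε w) x = ∑ i, (η i x • gradient w (x + -(ε • d i)) +
      w (x + -(ε • d i)) • gradient (η i) x) := by
    simp_rw [← gradient_translate w]
    simp only [gradient, h4, map_sum, map_add, map_smul]
  rw [h5, Finset.sum_add_distrib]
  simp_rw [sub_smul]
  rw [Finset.sum_sub_distrib, ← Finset.smul_sum, h1, smul_zero, sub_zero]

/-- Young's inequality with parameter $\theta$ separates the two sums. The main one is a sub-convex
combination, so Cauchy–Schwarz with weights $\eta_i$ bounds it with constant $1$; the other may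
carry a large constant. -/
theorem InwardPartition.norm_gradient_glue_sq_le (hP : InwardPartition Ω t η d κ ε₀ L)
    (hΩ : IsOpen Ω) {w u : EuclideanSpace ℝ (Fin N) → ℝ} (hw : IsTestFunction univ w) (ε : ℝ)
    {θ : ℝ} (hθ : 0 < θ) {x : EuclideanSpace ℝ (Fin N)} (hx : x ∈ Ω) :
    ‖gradient (glue η d ε w) x‖ ^ 2 ≤
      (1 + θ) * ∑ i, η i x * ‖gradient w (x + -(ε • d i))‖ ^ 2 +
      (1 + θ⁻¹) * (t.card * L ^ 2) * ∑ i, (w (x + -(ε • d i)) - u x) ^ 2 := by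
  rw [hP.gradient_glue hΩ hw ε hx (u := u), mul_assoc (1 + θ⁻¹)]
  refine (norm_add_sq_le _ _ hθ).trans ?_
  gcongr
  · have h1 : ‖∑ i, η i x • gradient w (x + -(ε • d i))‖ ≤
        ∑ i, η i x * ‖gradient w (x + -(ε • d i))‖ := by
      refine (norm_sum_le _ _).trans (Finset.sum_le_sum fun i _ => ?_)
      rw [norm_smul, Real.norm_of_nonneg (hP.nonneg i x)]
    refine (pow_le_pow_left₀ (norm_nonneg _) h1 2).trans ?_
    refine (Finset.sum_sq_le_sum_mul_sum_of_sq_le_mul (f := fun i => η i x)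
      (g := fun i => η i x * ‖gradient w (x + -(ε • d i))‖ ^ 2) _ (fun i _ => hP.nonneg i x)
      (fun i _ => mul_nonneg (hP.nonneg i x) (sq_nonneg _))
      fun i _ => le_of_eq (by ring)).trans ?_
    exact mul_le_of_le_one_left (Finset.sum_nonneg fun i _ =>
      mul_nonneg (hP.nonneg i x) (sq_nonneg _)) (hP.sum_le_one x)
  · have h1 : ‖∑ i, (w (x + -(ε • d i)) - u x) • gradient (η i) x‖ ≤
        ∑ i, |w (x + -(ε • d i)) - u x| * L := by
      refine (norm_sum_le _ _).trans (Finset.sum_le_sum fun i _ => ?_)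
      rw [norm_smul, Real.norm_eq_abs]
      gcongr
      exact hP.norm_gradient_le i x
    refine (pow_le_pow_left₀ (norm_nonneg _) h1 2).trans ?_
    rw [← Finset.sum_mul, mul_pow]
    have h2 := sq_sum_le_card_mul_sum_sq (s := (Finset.univ : Finset t))
      (f := fun i => |w (x + -(ε • d i)) - u x|)
    simp only [sq_abs, Finset.card_univ, Fintype.card_coe] at h2
    calc _ ≤ (t.card * ∑ i, (w (x + -(ε • d i)) - u x) ^ 2) * L ^ 2 := by gcongr
      _ = _ := by ring

theorem enorm_sq_eq_ofReal {F : Type*} [NormedAddCommGroup F] (x : F) :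
    ‖x‖ₑ ^ 2 = ENNReal.ofReal (‖x‖ ^ 2) := by
  rw [← ofReal_norm, ENNReal.ofReal_pow (norm_nonneg _)]

/-- A change of variables moves each translation onto its weight. The shifted weights still sum to
almost one, by their Lipschitz bound, so the overlap of the charts costs no fixed factor. -/
theorem InwardPartition.lintegral_sum_translate_le (hP : InwardPartition Ω t η d κ ε₀ L)
    {w : EuclideanSpace ℝ (Fin N) → ℝ} (hw : IsTestFunction univ w) {ε : ℝ} (hε : 0 ≤ ε) :
    ∫⁻ x, ∑ i, ENNReal.ofReal (η i x) * ‖gradient w (x + -(ε • d i))‖ₑ ^ 2 ≤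
      ENNReal.ofReal (1 + t.card * L * ε) * ∫⁻ x, ‖gradient w x‖ₑ ^ 2 := by
  have hgm : Measurable (gradient w) := hw.continuous_gradient.measurable
  have hηm : ∀ i, Measurable (η i) := fun i => (hP.isTest i).continuous.measurable
  have hL := hP.L_nonneg
  rw [lintegral_finsetSum _ fun i _ => by have := hηm i; fun_prop]
  have h1 : ∀ i, ∫⁻ x, ENNReal.ofReal (η i x) * ‖gradient w (x + -(ε • d i))‖ₑ ^ 2 =
      ∫⁻ x, ENNReal.ofReal (η i (x + ε • d i)) * ‖gradient w x‖ₑ ^ 2 := by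
    intro i
    rw [← lintegral_add_right_eq_self (μ := volume) _ (ε • d i)]
    simp
  simp_rw [h1]
  rw [← lintegral_finsetSum _ fun i _ => by have := hηm i; fun_prop,
    ← lintegral_const_mul _ (by fun_prop)]
  refine lintegral_mono fun x => ?_
  simp only
  rw [← Finset.sum_mul]
  gcongr
  rw [← ENNReal.ofReal_sum_of_nonneg fun i _ => hP.nonneg i _]
  apply ENNReal.ofReal_le_ofReal
  have h2 : ∀ i, η i (x + ε • d i) ≤ η i x + L * ε := by
    intro i
    have h3 := (abs_le.1 (hP.abs_sub_le i (x + ε • d i) x)).2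
    rw [add_sub_cancel_left, norm_smul, Real.norm_of_nonneg hε] at h3
    have h4 : L * (ε * ‖d i‖) ≤ L * (ε * 1) := by
      have := hP.norm_le_one i
      gcongr
    linarith
  refine (Finset.sum_le_sum fun i _ => h2 i).trans ?_
  rw [Finset.sum_add_distrib]
  have := hP.sum_le_one x
  simp only [Finset.sum_const, Finset.card_univ, Fintype.card_coe, nsmul_eq_mul]
  linarith

theorem InwardPartition.lintegral_gradient_glue_le (hP : InwardPartition Ω t η d κ ε₀ L)
    (hΩ : IsOpen Ω) {w u : EuclideanSpace ℝ (Fin N) → ℝ} (hw : IsTestFunction univ w)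
    (hu : IsTestFunction univ u) {ε : ℝ} (hε : 0 ≤ ε) {θ : ℝ} (hθ : 0 < θ) :
    ∫⁻ x in Ω, ‖gradient (glue η d ε w) x‖ₑ ^ 2 ≤
      ENNReal.ofReal ((1 + θ) * (1 + t.card * L * ε)) * (∫⁻ x, ‖gradient w x‖ₑ ^ 2) +
      ENNReal.ofReal ((1 + θ⁻¹) * (t.card * L ^ 2)) *
        ∑ i, fracEnergy 0 (fun x => w (x + -(ε • d i)) - u x) := by
  have hgm : Measurable (gradient w) := hw.continuous_gradient.measurable
  have hηm : ∀ i, Measurable (η i) := fun i => (hP.isTest i).continuous.measurable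
  have hwm : Measurable w := hw.continuous.measurable
  have hum : Measurable u := hu.continuous.measurable
  have hL := hP.L_nonneg
  have hpt : ∀ x ∈ Ω, ‖gradient (glue η d ε w) x‖ₑ ^ 2 ≤
      ENNReal.ofReal (1 + θ) *
        ∑ i, ENNReal.ofReal (η i x) * ‖gradient w (x + -(ε • d i))‖ₑ ^ 2 +
      ENNReal.ofReal ((1 + θ⁻¹) * (t.card * L ^ 2)) *
        ∑ i, ‖w (x + -(ε • d i)) - u x‖ₑ ^ 2 := by
    intro x hx
    have hη := fun i => hP.nonneg i x
    simp_rw [enorm_sq_eq_ofReal, ← ENNReal.ofReal_mul (hη _), Real.norm_eq_abs, sq_abs]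
    rw [← ENNReal.ofReal_sum_of_nonneg fun i _ => mul_nonneg (hη i) (sq_nonneg _),
      ← ENNReal.ofReal_sum_of_nonneg fun i _ => sq_nonneg _, ← ENNReal.ofReal_mul (by positivity),
      ← ENNReal.ofReal_mul (by positivity), ← ENNReal.ofReal_add
        (mul_nonneg (by positivity)
          (Finset.sum_nonneg fun i _ => mul_nonneg (hη i) (sq_nonneg _))) (by positivity)]
    exact ENNReal.ofReal_le_ofReal (hP.norm_gradient_glue_sq_le hΩ hw ε hθ hx)
  refine (setLIntegral_mono' hΩ.measurableSet hpt).trans ?_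
  refine (setLIntegral_le_lintegral _ _).trans ?_
  rw [lintegral_add_right _ (by fun_prop), lintegral_const_mul' _ _ ENNReal.ofReal_ne_top,
    lintegral_const_mul' _ _ ENNReal.ofReal_ne_top, ENNReal.ofReal_mul (p := 1 + θ)
      (by positivity), mul_assoc (ENNReal.ofReal (1 + θ))]
  simp_rw [((hw.comp_add_right _).sub hu).fracEnergy_zero]
  rw [← lintegral_finsetSum _ fun i _ => by fun_prop]
  gcongr
  exact hP.lintegral_sum_translate_le hw hε

/-- On $\Omega$, $u$ is the glued function minus $\sum_i\eta_i\,(w(\cdot-\varepsilon d_i)-u)$, and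
$0\le\eta_i\le1$. -/
theorem InwardPartition.eLpNorm_glue_sub_le (hP : InwardPartition Ω t η d κ ε₀ L)
    (hΩ : IsOpen Ω) {w u : EuclideanSpace ℝ (Fin N) → ℝ} (hw : IsTestFunction univ w)
    (hu : IsTestFunction univ u) (ε : ℝ) {p : ℝ≥0∞} (hp : 1 ≤ p) :
    eLpNorm u p (volume.restrict Ω) ≤ eLpNorm (glue η d ε w) p (volume.restrict Ω) +
      ∑ i, eLpNorm (fun x => w (x + -(ε • d i)) - u x) p (volume.restrict Ω) := by
  have hf : ∀ i, AEStronglyMeasurable (fun x => w (x + -(ε • d i)) - u x)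
      (volume.restrict Ω) := fun i =>
    ((hw.comp_add_right _).sub hu).continuous.aestronglyMeasurable
  have hηm : ∀ i, Continuous (η i) := fun i => (hP.isTest i).continuous
  set F : t → EuclideanSpace ℝ (Fin N) → ℝ := fun i x => η i x * (w (x + -(ε • d i)) - u x)
  have hFm : ∀ i, AEStronglyMeasurable (F i) (volume.restrict Ω) := fun i =>
    (hηm i).aestronglyMeasurable.mul (hf i)
  have hglue : AEStronglyMeasurable (glue η d ε w) (volume.restrict Ω) := by
    refine Continuous.aestronglyMeasurable ?_
    exact continuous_finsetSum _ fun i _ => (hηm i).mul (hw.comp_add_right _).continuous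
  have h1 : u =ᵐ[volume.restrict Ω] glue η d ε w - ∑ i, F i := by
    filter_upwards [ae_restrict_mem hΩ.measurableSet] with x hx
    simp only [Pi.sub_apply, Finset.sum_apply, F, glue, mul_sub, Finset.sum_sub_distrib,
      ← Finset.sum_mul, hP.sum_eq_one x hx]
    ring
  rw [eLpNorm_congr_ae h1]
  refine (eLpNorm_sub_le hglue (Finset.aestronglyMeasurable_sum _ fun i _ => hFm i) hp).trans ?_
  gcongr
  refine (eLpNorm_sum_le (fun i _ => hFm i) hp).trans (Finset.sum_le_sum fun i _ => ?_)
  refine eLpNorm_mono fun x => ?_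
  rw [norm_mul, Real.norm_of_nonneg (hP.nonneg i x)]
  refine mul_le_of_le_one_left (norm_nonneg _) ?_
  exact (Finset.single_le_sum (fun j _ => hP.nonneg j x) (Finset.mem_univ i)).trans
    (hP.sum_le_one x)

end Recovery

/-! ### The lower bound -/

section LowerBound

variable {N : ℕ} {Ω : Set (EuclideanSpace ℝ (Fin N))}

theorem rpow_le_rpow_of_base_le_one {a x p r : ℝ} (ha0 : 0 ≤ a) (hax : a ≤ x) (hx1 : x ≤ 1)
    (hp : 0 < p) (hpr : p ≤ r) : a ^ r ≤ x ^ p := by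
  have hr : 0 < r := hp.trans_le hpr
  rcases (ha0.trans hax).eq_or_lt with h | h
  · have : a = 0 := le_antisymm (hax.trans h.ge) ha0
    rw [this, Real.zero_rpow hr.ne']
    positivity
  · exact (Real.rpow_le_rpow ha0 hax hr.le).trans
      (Real.rpow_le_rpow_of_exponent_ge h hx1 hpr)

theorem fracEnergy_le_of_gagliardoSq_le [NeZero N] {u : EuclideanSpace ℝ (Fin N) → ℝ}
    (hu : IsTestFunction univ u) {e : EuclideanSpace ℝ (Fin N)} (he : ‖e‖ = 1) {s a M : ℝ}
    (hs : 0 < s) (ha : 0 < a) (hK : ENNReal.ofReal a ≤ ENNReal.ofReal (1 - s) * fracSymbol s e)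
    (hE : ENNReal.ofReal (1 - s) * gagliardoSq s u ≤ ENNReal.ofReal (M ^ 2)) :
    fracEnergy s u ≤ ENNReal.ofReal (a⁻¹ * M ^ 2) := by
  have h1 : ENNReal.ofReal a * fracEnergy s u ≤ ENNReal.ofReal (M ^ 2) := by
    refine le_trans ?_ hE
    rw [hu.gagliardoSq_eq hs he, ← mul_assoc]
    gcongr
  calc fracEnergy s u = ENNReal.ofReal a⁻¹ * (ENNReal.ofReal a * fracEnergy s u) := by
        rw [← mul_assoc, ← ENNReal.ofReal_mul (by positivity), inv_mul_cancel₀ ha.ne']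
        simp
    _ ≤ ENNReal.ofReal a⁻¹ * ENNReal.ofReal (M ^ 2) := by gcongr
    _ = _ := by rw [← ENNReal.ofReal_mul (by positivity)]

theorem InwardPartition.exists_parameter {t : Finset (EuclideanSpace ℝ (Fin N))}
    {η : t → EuclideanSpace ℝ (Fin N) → ℝ} {d : t → EuclideanSpace ℝ (Fin N)} {κ ε₀ L : ℝ}
    (hP : InwardPartition Ω t η d κ ε₀ L) {τ θ A B σ : ℝ} (hτ : 0 < τ) (hθ : 0 < θ) (hσ : σ < 1) :
    ∃ ε, 0 < ε ∧ ε < ε₀ ∧ 2 * Real.pi * ε ≤ 1 ∧ t.card * L * ε ≤ θ ∧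
      A * (2 * Real.pi * ε) ≤ τ / 2 ∧ B * (2 * Real.pi * ε) ^ ((1 - σ) / 2) ≤ τ := by
  have hsmall : ∀ (f : ℝ → ℝ) (b : ℝ), Continuous f → f 0 = 0 → 0 < b →
      ∀ᶠ ε in 𝓝[>] (0 : ℝ), f ε ≤ b := by
    intro f b hf h0 hb
    have h1 : Tendsto f (𝓝[>] 0) (𝓝 0) := by
      simpa [h0] using (hf.tendsto 0).mono_left (nhdsWithin_le_nhds (s := Ioi 0))
    exact (h1.eventually_lt_const hb).mono fun _ h => h.le
  have hexp : 0 < (1 - σ) / 2 := by linarith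
  have hpow : Continuous fun ε : ℝ => (2 * Real.pi * ε) ^ ((1 - σ) / 2) :=
    (Real.continuous_rpow_const hexp.le).comp (by fun_prop : Continuous fun ε : ℝ =>
      2 * Real.pi * ε)
  have h0 : ∀ᶠ ε in 𝓝[>] (0 : ℝ), 0 < ε := self_mem_nhdsWithin
  have h1 : ∀ᶠ ε in 𝓝[>] (0 : ℝ), ε < ε₀ :=
    mem_nhdsWithin_of_mem_nhds (Iio_mem_nhds hP.ε₀_pos)
  have h2 := hsmall (fun ε => 2 * Real.pi * ε) 1 (by fun_prop) (by simp) one_pos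
  have h3 := hsmall (fun ε => t.card * L * ε) θ (by fun_prop) (by simp) hθ
  have h4 := hsmall (fun ε => A * (2 * Real.pi * ε)) (τ / 2) (by fun_prop) (by simp) (by positivity)
  have h5 := hsmall (fun ε => B * (2 * Real.pi * ε) ^ ((1 - σ) / 2)) τ (by fun_prop)
    (by simp [Real.zero_rpow hexp.ne']) hτ
  obtain ⟨ε, hε⟩ := (h0.and (h1.and (h2.and (h3.and (h4.and h5))))).exists
  exact ⟨ε, hε⟩

/-- The recovery step. The parameters are chosen in the order $\tau$, $\theta$, $\varepsilon$,
mollifier, and last the range of $s$; none depends on $u$ or $M$, so one range of $s$ serves every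
function. -/
theorem InwardPartition.eventually_exists_testFunction [NeZero N]
    {t : Finset (EuclideanSpace ℝ (Fin N))}
    {η : t → EuclideanSpace ℝ (Fin N) → ℝ} {d : t → EuclideanSpace ℝ (Fin N)} {κ ε₀ L : ℝ}
    (hP : InwardPartition Ω t η d κ ε₀ L) (hΩ : IsOpen Ω) (hb : Bornology.IsBounded Ω)
    {q σ : ℝ} (hσ0 : 0 < σ) (hσ1 : σ < 1) (hσN : 2 * σ < N) (hq : 1 ≤ q)
    (hqσ : q * (N - 2 * σ) < 2 * N) {τ : ℝ} (hτ : 0 < τ) :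
    ∀ᶠ s in 𝓝[<] (1 : ℝ), ∀ u : EuclideanSpace ℝ (Fin N) → ℝ, IsTestFunction Ω u → ∀ M : ℝ, 0 < M →
      ENNReal.ofReal (1 - s) * gagliardoSq s u ≤ ENNReal.ofReal (M ^ 2) →
      ∃ v, IsTestFunction Ω v ∧
        unitBallVolume N / 2 * ∫⁻ x in Ω, ‖gradient v x‖ₑ ^ 2 ≤ ENNReal.ofReal ((1 + τ) * M ^ 2) ∧
        eLpNorm u (ENNReal.ofReal q) (volume.restrict Ω) ≤
          eLpNorm v (ENNReal.ofReal q) (volume.restrict Ω) + ENNReal.ofReal (τ * M) := by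
  obtain ⟨e, he⟩ := exists_norm_eq_one (N := N)
  obtain ⟨S, hS0, hS⟩ := exists_eLpNorm_le_fracEnergy (N := N) hσ0 hσN (by linarith) hqσ
    (hb.measure_lt_top (μ := volume)).ne
  have hL := hP.L_nonneg
  set W : ℝ := (unitBallVolume N).toReal with hW
  have hWt : unitBallVolume N = ENNReal.ofReal W :=
    (ENNReal.ofReal_toReal (unitBallVolume_ne_top N)).symm
  have hW0 : 0 < W := ENNReal.toReal_pos (unitBallVolume_ne_zero N) (unitBallVolume_ne_top N)
  have hWhalf : unitBallVolume N / 2 = ENNReal.ofReal (W / 2) := by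
    rw [hWt, ENNReal.ofReal_div_of_pos two_pos, ENNReal.ofReal_ofNat]
  set k : ℝ := 2 * Real.pi ^ 2 * W with hk
  have hk0 : 0 < k := by positivity
  have hkt : ENNReal.ofReal (2 * Real.pi ^ 2) * unitBallVolume N = ENNReal.ofReal k := by
    rw [hWt, ← ENNReal.ofReal_mul (by positivity)]
  set θ : ℝ := min 1 (τ / 30) with hθ
  have hθ0 : 0 < θ := lt_min one_pos (by positivity)
  have hθ1 : θ ≤ 1 := min_le_left _ _
  have hθτ : θ ≤ τ / 30 := min_le_right _ _
  -- Four factors $1+\theta$ are lost: in the symbol, in the mollification constant, in Young's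
  -- inequality and in the shifted weights. As $(1+\theta)^4\le1+15\theta$, the choice
  -- $\theta\le\tau/30$ spends half of $\tau$, leaving half for the error term.
  have hθ4 : (1 + θ) * (1 + θ) * ((1 + θ) * (1 + θ)) ≤ 1 + τ / 2 := by
    have h1 : (1 + θ) * (1 + θ) ≤ 1 + 3 * θ := by nlinarith
    have h2 : (1 + θ) * (1 + θ) * ((1 + θ) * (1 + θ)) ≤ (1 + 3 * θ) * (1 + 3 * θ) := by gcongr
    nlinarith
  set m : ℝ := (t.card : ℝ) with hm
  set c : ℝ := 2 / k with hc
  have hc0 : 0 < c := by positivity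
  have hm0 : 0 ≤ m := Nat.cast_nonneg _
  clear_value m
  obtain ⟨ε, hε0, hεε₀, hε1, hεL, hεA, hεB⟩ := hP.exists_parameter
    (A := W / 2 * ((1 + θ⁻¹) * (m * L ^ 2)) * (m * (4 * c)))
    (B := m * (S * (2 * √c))) hτ hθ0 hσ1
  rw [← hm] at hεL
  obtain ⟨ρ, hρ⟩ := exists_isMollifier (N := N) (mul_pos hP.κ_pos hε0)
  obtain ⟨R, hR0, hR⟩ := exists_fracEnergy_one_mollify_le hρ
  have s1 : ∀ᶠ s in 𝓝[<] (1 : ℝ),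
      ENNReal.ofReal (k / (1 + θ)) < ENNReal.ofReal (1 - s) * fracSymbol s e := by
    refine (tendsto_mul_fracSymbol he).eventually_const_lt ?_
    change _ < ENNReal.ofReal (2 * Real.pi ^ 2) * unitBallVolume N
    rw [hkt]
    exact (ENNReal.ofReal_lt_ofReal_iff hk0).2 (div_lt_self hk0 (by linarith))
  have s2 : ∀ᶠ s in 𝓝[<] (1 : ℝ), R ^ (2 * (1 - s)) < 1 + θ := by
    have hcont : Continuous fun s : ℝ => R ^ (2 * (1 - s)) :=
      (Real.continuous_const_rpow hR0.ne').comp (by fun_prop : Continuous fun s : ℝ => 2 * (1 - s))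
    have := (hcont.tendsto 1).mono_left (nhdsWithin_le_nhds (s := Iio 1))
    simp only [sub_self, mul_zero, Real.rpow_zero] at this
    exact this.eventually_lt_const (by linarith)
  -- This threshold ensures both $2s\ge1$ and $2(s-\sigma)\ge1-\sigma$, the exponents used at orders
  -- $0$ and $\sigma$ and independent of $s$.
  have s3 : ∀ᶠ s in 𝓝[<] (1 : ℝ), (1 + σ) / 2 < s :=
    mem_nhdsWithin_of_mem_nhds (Ioi_mem_nhds (by linarith))
  filter_upwards [s1, s2, s3, self_mem_nhdsWithin] with s hs1 hs2 hs3 hs4 u hu M hM hE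
  have hs4' : s < 1 := hs4
  have hs0 : 0 < s := by linarith
  have hu' := hu.to_univ
  have hw := hρ.isTest.mollify hu'
  have hH := fracEnergy_le_of_gagliardoSq_le hu' he hs0 (by positivity) hs1.le hE
  rw [inv_div] at hH
  have hHc : fracEnergy s u ≤ ENNReal.ofReal (c * M ^ 2) := by
    refine hH.trans (ENNReal.ofReal_le_ofReal ?_)
    rw [hc]
    gcongr
    linarith
  have hδ : 0 ≤ κ * ε := (mul_pos hP.κ_pos hε0).le
  have hshift : ∀ i, Real.pi * (‖-(ε • d i)‖ + κ * ε) ≤ 2 * Real.pi * ε := by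
    intro i
    rw [norm_neg, norm_smul, Real.norm_of_nonneg hε0.le]
    have h1 : ε * ‖d i‖ ≤ ε * 1 := by
      have := hP.norm_le_one i
      gcongr
    have h2 : κ * ε ≤ 1 * ε := by
      have := hP.κ_le_one
      gcongr
    have h3 : ε * ‖d i‖ + κ * ε ≤ 2 * ε := by linarith
    calc _ ≤ Real.pi * (2 * ε) := by gcongr
      _ = _ := by ring
  have hfrac : ∀ (r p : ℝ), 0 ≤ r → 0 < p → p ≤ 2 * (s - r) → ∀ i,
      fracEnergy r (fun x => mollify ρ u (x + -(ε • d i)) - u x) ≤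
        ENNReal.ofReal (4 * (2 * Real.pi * ε) ^ p * (c * M ^ 2)) := by
    intro r p hr hp hpr i
    refine (fracEnergy_mollify_translate_sub_le (σ := r) (s := s) hρ hu' _ (by linarith) (by linarith)
      hδ).trans ?_
    rw [ENNReal.ofReal_mul (p := 4 * (2 * Real.pi * ε) ^ p) (by positivity)]
    gcongr
    exact rpow_le_rpow_of_base_le_one (by positivity) (hshift i) hε1 hp hpr
  refine ⟨glue η d ε (mollify ρ u), hP.isTestFunction_glue hε0 hεε₀ hρ hu, ?_, ?_⟩
  · have hgw : unitBallVolume N / 2 * ∫⁻ x, ‖gradient (mollify ρ u) x‖ₑ ^ 2 ≤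
        ENNReal.ofReal ((1 + θ) * (1 + θ) * M ^ 2) := by
      rw [hw.lintegral_gradient_sq, half_unitBallVolume_mul, hkt]
      calc _ ≤ ENNReal.ofReal k * (ENNReal.ofReal (R ^ (2 * (1 - s))) *
            ENNReal.ofReal ((1 + θ) / k * M ^ 2)) := by
            gcongr
            exact (hR u hu' s hs0.le hs4'.le).trans (by gcongr)
        _ = ENNReal.ofReal (k * (R ^ (2 * (1 - s)) * ((1 + θ) / k * M ^ 2))) := by
            rw [← ENNReal.ofReal_mul (by positivity), ← ENNReal.ofReal_mul (by positivity)]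
        _ ≤ _ := by
            apply ENNReal.ofReal_le_ofReal
            calc _ ≤ k * ((1 + θ) * ((1 + θ) / k * M ^ 2)) := by gcongr
              _ = _ := by field_simp
    have hsum : ∑ i, fracEnergy 0 (fun x => mollify ρ u (x + -(ε • d i)) - u x) ≤
        ENNReal.ofReal (m * (4 * (2 * Real.pi * ε) * (c * M ^ 2))) := by
      refine (Finset.sum_le_sum fun i _ => hfrac 0 1 le_rfl one_pos (by linarith) i).trans
        (le_of_eq ?_)
      rw [Real.rpow_one, Finset.sum_const, Finset.card_univ, Fintype.card_coe, nsmul_eq_mul,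
        ENNReal.ofReal_mul (p := m) (by positivity), hm, ENNReal.ofReal_natCast]
    have hmain := hP.lintegral_gradient_glue_le hΩ hw hu' hε0.le hθ0
    rw [← hm] at hmain
    calc _ ≤ unitBallVolume N / 2 * (ENNReal.ofReal ((1 + θ) * (1 + m * L * ε)) *
          (∫⁻ x, ‖gradient (mollify ρ u) x‖ₑ ^ 2) + ENNReal.ofReal ((1 + θ⁻¹) * (m * L ^ 2)) *
          ∑ i, fracEnergy 0 (fun x => mollify ρ u (x + -(ε • d i)) - u x)) := by gcongr
      _ = ENNReal.ofReal ((1 + θ) * (1 + m * L * ε)) * (unitBallVolume N / 2 *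
          ∫⁻ x, ‖gradient (mollify ρ u) x‖ₑ ^ 2) + ENNReal.ofReal (W / 2) *
          (ENNReal.ofReal ((1 + θ⁻¹) * (m * L ^ 2)) *
          ∑ i, fracEnergy 0 (fun x => mollify ρ u (x + -(ε • d i)) - u x)) := by
            rw [← hWhalf]; ring
      _ ≤ ENNReal.ofReal ((1 + θ) * (1 + θ)) * ENNReal.ofReal ((1 + θ) * (1 + θ) * M ^ 2) +
          ENNReal.ofReal (W / 2) * (ENNReal.ofReal ((1 + θ⁻¹) * (m * L ^ 2)) *
          ENNReal.ofReal (m * (4 * (2 * Real.pi * ε) * (c * M ^ 2)))) := by gcongr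
      _ = ENNReal.ofReal ((1 + θ) * (1 + θ) * ((1 + θ) * (1 + θ)) * M ^ 2 +
          W / 2 * ((1 + θ⁻¹) * (m * L ^ 2)) * (m * (4 * c)) * (2 * Real.pi * ε) * M ^ 2) := by
            rw [← ENNReal.ofReal_mul (by positivity), ← ENNReal.ofReal_mul (by positivity),
              ← ENNReal.ofReal_mul (by positivity), ← ENNReal.ofReal_add (by positivity)
              (by positivity)]
            congr 1
            ring
      _ ≤ _ := by
            apply ENNReal.ofReal_le_ofReal
            calc _ ≤ (1 + τ / 2) * M ^ 2 + τ / 2 * M ^ 2 := by gcongr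
              _ = _ := by ring
  · refine (hP.eLpNorm_glue_sub_le hΩ hw hu' ε (p := ENNReal.ofReal q) (by simpa using hq)).trans ?_
    gcongr
    -- $M_f^2$ is exactly the bound for the energy of order $\sigma$ of each difference, as the
    -- Sobolev inequality requires; the square root produces the exponent $(1-\sigma)/2$.
    set Mf : ℝ := 2 * √c * (2 * Real.pi * ε) ^ ((1 - σ) / 2) * M with hMf
    have hMf0 : 0 < Mf := by positivity
    have hMf2 : Mf ^ 2 = 4 * (2 * Real.pi * ε) ^ (1 - σ) * (c * M ^ 2) := by
      have h1 : ((2 * Real.pi * ε) ^ ((1 - σ) / 2)) ^ 2 = (2 * Real.pi * ε) ^ (1 - σ) := by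
        rw [← Real.rpow_natCast, ← Real.rpow_mul (by positivity)]
        congr 1
        push_cast
        ring
      rw [hMf, mul_pow, mul_pow, mul_pow, Real.sq_sqrt hc0.le, h1]
      ring
    have hterm : ∀ i, eLpNorm (fun x => mollify ρ u (x + -(ε • d i)) - u x) (ENNReal.ofReal q)
        (volume.restrict Ω) ≤ ENNReal.ofReal (S * Mf) := by
      intro i
      refine hS _ ((hw.comp_add_right _).sub hu') Mf hMf0 ?_
      rw [hMf2]
      exact hfrac σ (1 - σ) hσ0.le (by linarith) (by linarith) i
    refine (Finset.sum_le_sum fun i _ => hterm i).trans ?_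
    rw [Finset.sum_const, Finset.card_univ, Fintype.card_coe, nsmul_eq_mul,
      ← ENNReal.ofReal_natCast, ← hm, ← ENNReal.ofReal_mul hm0]
    apply ENNReal.ofReal_le_ofReal
    calc _ = m * (S * (2 * √c)) * (2 * Real.pi * ε) ^ ((1 - σ) / 2) * M := by rw [hMf]; ring
      _ ≤ _ := by gcongr

/-- Subcriticality of $q$ reads $q(N-2)<2N$, also for $N=2$, and a strict inequality persists for
orders slightly below $1$. -/
theorem exists_subcritical_order (hN : 2 ≤ N) {q : ℝ} (hq : 1 ≤ q)
    (hq' : ENNReal.ofReal q < sobolevExponent N) :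
    ∃ σ : ℝ, 0 < σ ∧ σ < 1 ∧ 2 * σ < N ∧ q * (N - 2 * σ) < 2 * N := by
  have hN2 : (2 : ℝ) ≤ N := by exact_mod_cast hN
  have h1 : q * (N - 2 * 1) < 2 * N := by
    rw [sobolevExponent] at hq'
    split_ifs at hq' with h3
    · have h3' : (3 : ℝ) ≤ N := by exact_mod_cast h3
      rw [ENNReal.ofReal_lt_ofReal_iff_of_nonneg (by linarith), lt_div_iff₀ (by linarith)] at hq'
      simpa using hq'
    · have : N = 2 := by omega
      subst this
      norm_num
  have hlim : Tendsto (fun σ : ℝ => q * (N - 2 * σ)) (𝓝[<] 1) (𝓝 (q * (N - 2 * 1))) :=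
    (Continuous.tendsto (by fun_prop) 1).mono_left nhdsWithin_le_nhds
  obtain ⟨σ, hσ, hσ1, hσ0⟩ := ((hlim.eventually_lt_const h1).and
    (eventually_mem_nhdsWithin.and (mem_nhdsWithin_of_mem_nhds (lt_mem_nhds one_pos)))).exists
  have hσ1' : σ < 1 := hσ1
  exact ⟨σ, hσ0, hσ1', by linarith, hσ⟩

/-- A normalized function with fractional energy below $b/(1-s)$ would yield, through the recovery
step, a test function whose local quotient falls below the infimum. -/
theorem HasLipschitzBoundary.eventually_le_fracPoincareSobolev (hL : HasLipschitzBoundary Ω)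
    (hN : 2 ≤ N) {q : ℝ} (hq : 1 ≤ q) (hq' : ENNReal.ofReal q < sobolevExponent N)
    (hΩ : IsOpen Ω) (hb : Bornology.IsBounded Ω) {b : ℝ≥0∞}
    (hbl : b < unitBallVolume N / 2 * poincareSobolev q Ω) :
    ∀ᶠ s in 𝓝[<] (1 : ℝ), b ≤ ENNReal.ofReal (1 - s) * fracPoincareSobolev s q Ω := by
  have : NeZero N := ⟨by omega⟩
  obtain ⟨σ, hσ0, hσ1, hσN, hqσ⟩ := exists_subcritical_order hN hq hq'
  obtain ⟨t, η, d, κ, ε₀, L, hP⟩ := hL.exists_inwardPartition hΩ hb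
  rcases eq_or_ne b 0 with rfl | hb0
  · simp
  -- A finite intermediate value replaces the local constant, which may be infinite, and leaves room
  -- for the errors in $\tau$.
  obtain ⟨b', hbb', hb'⟩ := exists_between hbl
  have hb't : b' ≠ ⊤ := hb'.ne_top
  have hbt : b ≠ ⊤ := hbl.ne_top
  set β := b.toReal with hβ
  set β' := b'.toReal with hβ'
  have hβ0 : 0 < β := ENNReal.toReal_pos hb0 hbt
  have hββ' : β < β' := (ENNReal.toReal_lt_toReal hbt hb't).2 hbb'
  set M := √β with hMdef
  have hM : 0 < M := Real.sqrt_pos.2 hβ0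
  have hM2 : ENNReal.ofReal (M ^ 2) = b := by
    rw [hMdef, Real.sq_sqrt hβ0.le, hβ, ENNReal.ofReal_toReal hbt]
  -- The norm drops by $\tau$ on passing to a test function and by $\tau M$ in the recovery, while
  -- the energy grows by the factor $1+\tau$; the last inequality makes these losses contradict
  -- $b<b'$.
  obtain ⟨τ, hτ0, hτ1, hτ⟩ : ∃ τ, 0 < τ ∧ τ * (1 + M) < 1 ∧
      (1 + τ) * β < β' * (1 - τ * (1 + M)) ^ 2 := by
    have c1 : Tendsto (fun τ : ℝ => τ * (1 + M)) (𝓝[>] 0) (𝓝 (0 * (1 + M))) :=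
      (Continuous.tendsto (by fun_prop) 0).mono_left nhdsWithin_le_nhds
    have c2 : Tendsto (fun τ : ℝ => (1 + τ) * β) (𝓝[>] 0) (𝓝 ((1 + 0) * β)) :=
      (Continuous.tendsto (by fun_prop) 0).mono_left nhdsWithin_le_nhds
    have c3 : Tendsto (fun τ : ℝ => β' * (1 - τ * (1 + M)) ^ 2) (𝓝[>] 0)
        (𝓝 (β' * (1 - 0 * (1 + M)) ^ 2)) :=
      (Continuous.tendsto (by fun_prop) 0).mono_left nhdsWithin_le_nhds
    have e1 := c1.eventually_lt_const (u := 1) (by simp)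
    have e2 := c2.eventually_lt c3 (by simpa using hββ')
    obtain ⟨τ, h0, h1, h2⟩ := (eventually_mem_nhdsWithin.and (e1.and e2)).exists
    exact ⟨τ, h0, h1, h2⟩
  filter_upwards [hP.eventually_exists_testFunction hΩ hb hσ0 hσ1 hσN hq hqσ hτ0,
    self_mem_nhdsWithin] with s hs hs1
  have hs1' : 0 < 1 - s := sub_pos.2 hs1
  have hp0 : ENNReal.ofReal (1 - s) ≠ 0 := (ENNReal.ofReal_pos.2 hs1').ne'
  have hpt : ENNReal.ofReal (1 - s) ≠ ⊤ := ENNReal.ofReal_ne_top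
  rw [← ENNReal.div_le_iff' hp0 hpt]
  refine le_sInf ?_
  rintro E ⟨u, hu, hn, rfl⟩
  by_contra! hlt
  have ha : ENNReal.ofReal (1 - τ) < eLpNorm u (ENNReal.ofReal q) (volume.restrict Ω) := by
    rw [hn]
    exact ENNReal.ofReal_lt_one.2 (by linarith)
  obtain ⟨φ, hφ, hφB, hφa⟩ := hu.exists_testFunction hb _ ha hlt
  have hφM : ENNReal.ofReal (1 - s) * gagliardoSq s φ ≤ ENNReal.ofReal (M ^ 2) := by
    rw [hM2]
    calc _ ≤ ENNReal.ofReal (1 - s) * (b / ENNReal.ofReal (1 - s)) := by gcongr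
      _ = b := ENNReal.mul_div_cancel hp0 hpt
  obtain ⟨v, hv, hvE, hvn⟩ := hs φ hφ M hM hφM
  have h1 : ENNReal.ofReal (1 - τ * (1 + M)) ≤
      eLpNorm v (ENNReal.ofReal q) (volume.restrict Ω) := by
    have h2 := hφa.le.trans hvn
    rw [← tsub_le_iff_right, ← ENNReal.ofReal_sub _ (by positivity)] at h2
    rwa [show 1 - τ - τ * M = 1 - τ * (1 + M) by ring] at h2
  have h2 : ENNReal.ofReal (β' * (1 - τ * (1 + M)) ^ 2) ≤ ENNReal.ofReal ((1 + τ) * M ^ 2) := by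
    have hpos : 0 ≤ 1 - τ * (1 + M) := by linarith
    calc _ = b' * ENNReal.ofReal (1 - τ * (1 + M)) ^ 2 := by
          rw [ENNReal.ofReal_mul (hβ0.trans hββ').le, ENNReal.ofReal_pow hpos, hβ',
            ENNReal.ofReal_toReal hb't]
      _ ≤ unitBallVolume N / 2 * poincareSobolev q Ω *
          eLpNorm v (ENNReal.ofReal q) (volume.restrict Ω) ^ 2 := by gcongr
      _ ≤ unitBallVolume N / 2 * ∫⁻ x in Ω, ‖gradient v x‖ₑ ^ 2 := by
          rw [mul_assoc]
          gcongr
          exact hv.poincareSobolev_mul_le q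
      _ ≤ _ := hvE
  rw [ENNReal.ofReal_le_ofReal_iff (by positivity), hMdef, Real.sq_sqrt hβ0.le] at h2
  linarith

theorem HasLipschitzBoundary.le_liminf_fracPoincareSobolev (hL : HasLipschitzBoundary Ω)
    (hN : 2 ≤ N) {q : ℝ} (hq : 1 ≤ q) (hq' : ENNReal.ofReal q < sobolevExponent N)
    (hΩ : IsOpen Ω) (hb : Bornology.IsBounded Ω) :
    unitBallVolume N / 2 * poincareSobolev q Ω ≤
      liminf (fun s : ℝ => ENNReal.ofReal (1 - s) * fracPoincareSobolev s q Ω) (𝓝[<] 1) :=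
  le_of_forall_lt_imp_le_of_dense fun _ hbl =>
    le_liminf_of_le (h := hL.eventually_le_fracPoincareSobolev hN hq hq' hΩ hb hbl)

end LowerBound

theorem mainTheorem5 (N : ℕ) (hN : 2 ≤ N) (q : ℝ) (hq : 1 ≤ q)
    (hq' : ENNReal.ofReal q < sobolevExponent N)
    (Ω : Set (EuclideanSpace ℝ (Fin N))) (hΩ : IsOpen Ω) (hb : Bornology.IsBounded Ω) :
    limsup (fun s : ℝ => ENNReal.ofReal (1 - s) * fracPoincareSobolev s q Ω) (𝓝[<] 1)
        ≤ unitBallVolume N / 2 * poincareSobolev q Ω ∧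
    (HasLipschitzBoundary Ω →
      Tendsto (fun s : ℝ => ENNReal.ofReal (1 - s) * fracPoincareSobolev s q Ω) (𝓝[<] 1)
        (𝓝 (unitBallVolume N / 2 * poincareSobolev q Ω))) := by
  have : NeZero N := ⟨by omega⟩
  have h := limsup_fracPoincareSobolev_le q hΩ hb
  exact ⟨h, fun hL => tendsto_of_le_liminf_of_limsup_le
    (hL.le_liminf_fracPoincareSobolev hN hq hq' hΩ hb) h⟩
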